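/- Work in the universe $V$ of all sets, with arbitrary classes of sets allowed. All elementary embeddings are elementary for first-order formulas in the language $\{\in\}$ and go between transitive classes (with true membership). For a transitive class $N$ and $X\subseteq N$, let $H^N(X)$ be the class of all points of $N$ that are first-order definable in $(N,\in)$ from parameters in $X$. An elementary embedding $j:M\to N$ is an ultrapower embedding of $M$ if $N=H^N(j[M]\cup\{x\})$ for some $x\in N$. It is an internal ultrapower embedding of $M$ if moreover $j\restriction x\in M$ for all $x\in M$. A comparison of a pair $j_0:V\to M_0$, $j_1:V\to M_1$ of ultrapower embeddings is a pair of internal ultrapower embeddings $i_0:M_0\to N$ of $M_0$ and $i_1:M_1\to N$ of $M_1$, into a common transitive class $N$, such that $i_0\circ j_0=i_1\circ j_1$. An ordinal $\alpha$ is tail uniform if there is a countably complete ultrafilter $U$ on $\alpha$ with $\alpha\setminus\beta\in U$ for all $\beta<\alpha$. Let $\delta$ be an (infinite) regular cardinal. For an elementary embedding $j:V\to M$ write $\delta_*=\sup j[\delta]$. Then $j$ is a Ketonen embedding at $\delta$ if $M=H^M(j[V]\cup\{\delta_*\})$ and $\delta_*$ is not tail uniform in $M$. An ultrapower embedding $j:V\to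 M$ is zero order at $\delta$ if $\sup j[\delta]$ is not tail uniform in $M$. Let $\mathrm{KU}_\delta$ (the universal property of Ketonen embeddings at $\delta$) be the statement: whenever $j:V\to M$ is a Ketonen embedding at $\delta$ and $j':V\to M'$ is zero order at $\delta$, there is an internal ultrapower embedding $k:M\to M'$ of $M$ such that $j'=k\circ j$. Theorem. For every regular cardinal $\delta$, the following are equivalent: 1. $\mathrm{KU}_\delta$. 2. Whenever $j_0:V\to M_0$ is an ultrapower embedding and $j_1:V\to M_1$ is a Ketonen embedding at $\delta$, the pair $(j_0,j_1)$ admits a comparison. -/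

import Mathlib

open FirstOrder

universe u

namespace KetonenUniv

/-- The relation symbols of the language of set theory: one binary symbol. -/
inductive MemRel : ℕ → Type
  | mem : MemRel 2

/-- The first-order language `{∈}` of set theory. -/
def setLang : FirstOrder.Language.{0, 0} := ⟨fun _ => Empty, MemRel⟩

/-- A transitive class, that is, a transitive collection of members of the universe `ZFSet` of all
sets. Every transitive class into which the universe embeds elementarily is an inner model
of ZFC. -/
structure TransClass where
  /-- the members of the class -/
  carrier : Set ZFSet.{u}
  transitive : ∀ x ∈ carrier, ∀ y ∈ x, y ∈ carrier

instance : CoeSort TransClass.{u} (Type (u + 1)) := ⟨fun M => {x : ZFSet.{u} // x ∈ M.carrier}⟩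

/-- A transitive class, with the true membership relation, is a structure for `{∈}`. -/
instance (M : TransClass.{u}) : setLang.Structure M where
  funMap := fun f => f.elim
  RelMap := fun r =>
    match r with
    | MemRel.mem => fun v => (v 0 : M).1 ∈ (v 1 : M).1

/-- The universe `V` of all sets. -/
def V : TransClass.{u} := ⟨Set.univ, fun _ _ _ _ => trivial⟩

/-- A set, as an element of `V`. -/
def toV (x : ZFSet.{u}) : (V : TransClass.{u}) := ⟨x, trivial⟩

/-- `H^N(X)`: the points of `N` that are first-order definable in `(N, ∈)` from parameters
in `X`. -/
def hull (N : TransClass.{u}) (X : Set N) : Set N :=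
  {y | X.Definable₁ setLang {y}}

/-- An elementary embedding `j : M → N` is an ultrapower embedding of `M` if
`N = H^N(j[M] ∪ {x})` for some `x ∈ N`. -/
def IsUltrapower {M N : TransClass.{u}} (j : M ↪ₑ[setLang] N) : Prop :=
  ∃ x : N, hull N (Set.range j ∪ {x}) = Set.univ

/-- An internal ultrapower embedding of `M`: an ultrapower embedding `j` of `M` such that
`j ↾ x`, as a set of ordered pairs, belongs to `M` for every `x ∈ M`. -/
def IsInternalUltrapower {M N : TransClass.{u}} (j : M ↪ₑ[setLang] N) : Prop :=
  IsUltrapower j ∧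
    ∀ x : M, ∃ g : M, ∀ p : ZFSet.{u},
      p ∈ g.1 ↔ ∃ a : M, a.1 ∈ x.1 ∧ p = ZFSet.pair a.1 (j a).1

/-- The pair `(j₀, j₁)` of embeddings of `V` admits a comparison: there are a transitive class `N`
and internal ultrapower embeddings `i₀ : M₀ → N`, `i₁ : M₁ → N` with `i₀ ∘ j₀ = i₁ ∘ j₁`. -/
def HasComparison {M₀ M₁ : TransClass.{u}} (j₀ : V.{u} ↪ₑ[setLang] M₀)
    (j₁ : V.{u} ↪ₑ[setLang] M₁) : Prop :=
  ∃ (N : TransClass.{u}) (i₀ : M₀ ↪ₑ[setLang] N) (i₁ : M₁ ↪ₑ[setLang] N),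
    IsInternalUltrapower i₀ ∧ IsInternalUltrapower i₁ ∧ ∀ x, i₀ (j₀ x) = i₁ (j₁ x)

/-- `M` satisfies: `U` is an ultrafilter on the set `A`. -/
structure IsUltrafilterIn (M : TransClass.{u}) (A U : ZFSet.{u}) : Prop where
  mem_model : U ∈ M.carrier
  subset : ∀ X ∈ U, X ⊆ A
  whole_mem : A ∈ U
  empty_notMem : ∅ ∉ U
  upward : ∀ X ∈ U, ∀ Y ∈ M.carrier, X ⊆ Y → Y ⊆ A → Y ∈ U
  inter_mem : ∀ X ∈ U, ∀ Y ∈ U, X ∩ Y ∈ U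
  ultra : ∀ X ∈ M.carrier, X ⊆ A → X ∈ U ∨ A \ X ∈ U

/-- `M` satisfies: the ultrafilter `U` on `A` is countably complete, that is, the intersection of
every sequence `f : ω → U` belongs to `U`. -/
def IsCountablyCompleteIn (M : TransClass.{u}) (A U : ZFSet.{u}) : Prop :=
  ∀ f ∈ M.carrier, ZFSet.IsFunc Ordinal.omega0.toZFSet U f →
    ZFSet.sep (fun a => ∀ n X : ZFSet.{u}, ZFSet.pair n X ∈ f → a ∈ X) A ∈ U

/-- `M` satisfies: the ordinal `α` is tail uniform, that is, `α` carries a countably complete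
ultrafilter that contains `α \ β` for every `β < α`. -/
def IsTailUniformIn (M : TransClass.{u}) (α : ZFSet.{u}) : Prop :=
  ∃ U : ZFSet.{u}, IsUltrafilterIn M α U ∧ IsCountablyCompleteIn M α U ∧ ∀ β ∈ α, α \ β ∈ U

/-- `sup j[δ]`, the supremum (union) of the ordinals `j(ξ)` for `ξ < δ`. -/
noncomputable def supImage {M : TransClass.{u}} (j : V.{u} ↪ₑ[setLang] M) (δ : Cardinal.{u}) :
    ZFSet.{u} :=
  ZFSet.iUnion fun ξ : Set.Iio δ.ord => (j (toV ξ.1.toZFSet)).1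

/-- `j : V → M` is a Ketonen embedding at `δ`: with `δ_* = sup j[δ]`,
`M = H^M(j[V] ∪ {δ_*})` and `δ_*` is not tail uniform in `M`. -/
def IsKetonen (δ : Cardinal.{u}) {M : TransClass.{u}} (j : V.{u} ↪ₑ[setLang] M) : Prop :=
  hull M (Set.range j ∪ {x : M | x.1 = supImage j δ}) = Set.univ ∧
    ¬ IsTailUniformIn M (supImage j δ)

/-- An ultrapower embedding `j : V → M` is zero order at `δ` if `sup j[δ]` is not tail uniform
in `M`. -/
def IsZeroOrder (δ : Cardinal.{u}) {M : TransClass.{u}} (j : V.{u} ↪ₑ[setLang] M) : Prop :=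
  IsUltrapower j ∧ ¬ IsTailUniformIn M (supImage j δ)

/-- `KU_δ`, the universal property of Ketonen embeddings at `δ`: if `j : V → M` is Ketonen at `δ`
and `j' : V → M'` is zero order at `δ`, there is an internal ultrapower embedding `k : M → M'`
with `j' = k ∘ j`. -/
def KU (δ : Cardinal.{u}) : Prop :=
  ∀ (M M' : TransClass.{u}) (j : V.{u} ↪ₑ[setLang] M) (j' : V.{u} ↪ₑ[setLang] M'),
    IsKetonen δ j → IsZeroOrder δ j' →
      ∃ k : M ↪ₑ[setLang] M', IsInternalUltrapower k ∧ ∀ x, j' x = k (j x)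

end KetonenUniv

open KetonenUniv

/-!
The universal property of Ketonen embeddings at a regular cardinal `δ` is equivalent to the
comparability of Ketonen embeddings with arbitrary ultrapower embeddings.

*Comparisons give the universal property* (`KU_of_hasComparison`). Let `j : V → M` be Ketonen and
`j' : V → M'` zero order, and let `i₁ : M → N`, `i₀ : M' → N` be a comparison. An internal embedding
is continuous at every ordinal that is not tail uniform, because a discontinuity at `α` would yield
a derived countably complete tail ultrafilter on `α` (`map_supPoint`). So `i₁` and `i₀` send
`sup j[δ]` and `sup j'[δ]` to the same ordinal `sup (i₁ ∘ j)[δ] = sup (i₀ ∘ j')[δ]`. As `sup j[δ]`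
generates `M` over `j[V]`, the range of `i₁` is contained in that of `i₀`, and `k = i₀⁻¹ ∘ i₁` is
elementary. Ultrafilters derived from `k` are derived from the internal embedding `i₁`, so they
belong to `M`, and an ultrapower embedding of `M` whose derived ultrafilter belongs to `M` is
internal (`isInternalUltrapower_of_isDerived`).

*The universal property gives comparisons* (`hasComparison_of_KU`). It is enough to extend an
ultrapower embedding `j₀ : V → M₀` by an internal ultrapower embedding `k : M₀ → N` to one that is
zero order at `δ`, since the universal property then supplies the other half of the comparison. If
`α = sup j₀[δ]` is tail uniform in `M₀`, let `k` be the ultrapower of `M₀` by a tail ultrafilter on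
`α` that is minimal in the Ketonen order (`exists_not_isReducedBy`). A countably complete tail
ultrafilter of `N` on `sup k[α]` would be represented by a function in `M₀`, and its limit would be
a tail ultrafilter on `α` below the minimal one (`exists_internal_not_tailUniform`). The Ketonen
order is well-founded by a purely filter-theoretic argument (`not_descending_filters`).

First-order truth is handled through `FO`, the class of predicates on environments that are
given uniformly by a formula. What is proved in `V` for an `FO` predicate transfers to every
elementary target of `V`; in this way the targets satisfy choice, separation, and the existence of
Mostowski collapses and of minimal ultrafilters. The ordinal `ω` enters these predicates
as a parameter, which every elementary embedding fixes.
-/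

namespace KetonenUniv

/-! ### First-order predicates on transitive classes -/

/-- The environment `v` with `x` added as variable `0`. -/
def scons {α : Type*} (x : α) (v : ℕ → α) : ℕ → α
  | 0 => x
  | n + 1 => v n

@[simp] lemma scons_zero {α : Type*} (x : α) (v : ℕ → α) : scons x v 0 = x := rfl

lemma scons_succ {α : Type*} (x : α) (v : ℕ → α) (n : ℕ) : scons x v (n + 1) = v n := rfl

lemma scons_comp {α β : Type*} (f : α → β) (x : α) (v : ℕ → α) :
    (fun n => f (scons x v n)) = scons (f x) (fun n => f (v n)) := by
  funext n; cases n <;> rfl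

lemma scons_head_tail {α : Type*} (v : ℕ → α) : scons (v 0) (fun n => v (n + 1)) = v := by
  funext n; cases n <;> rfl

/-- The predicates on environments that are given, uniformly in all transitive classes, by a
first-order formula of set theory. Variables are de Bruijn indices: a quantifier binds
variable `0`. -/
inductive FO : (∀ M : TransClass.{u}, (ℕ → M) → Prop) → Prop
  | mem (i j : ℕ) : FO fun _ v => (v i).1 ∈ (v j).1
  | eq (i j : ℕ) : FO fun _ v => v i = v j
  | bot : FO fun _ _ => False
  | imp {P Q : ∀ M : TransClass.{u}, (ℕ → M) → Prop} : FO P → FO Q → FO fun M v => P M v → Q M v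
  | allCons {P : ∀ M : TransClass.{u}, (ℕ → M) → Prop} :
      FO P → FO fun M v => ∀ x : M, P M (scons x v)

namespace FO

variable {P Q : ∀ M : TransClass.{u}, (ℕ → M) → Prop}
  {R : ∀ M : TransClass.{u}, (ℕ → M) → M → Prop}

lemma congr (h : FO Q) (e : ∀ M v, P M v ↔ Q M v) : FO P := by
  have : P = Q := by funext M v; exact propext (e M v)
  exact this ▸ h

/-- The quantifier rule in higher-order form: the body of the quantifier is a first-order predicate
of the environment in which the bound variable is variable `0`. -/
lemma all (h : FO fun M v => R M (fun n => v (n + 1)) (v 0)) : FO fun M v => ∀ x : M, R M v x :=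
  allCons h

lemma not (h : FO P) : FO fun M v => ¬ P M v := imp h bot

lemma and (h : FO P) (h' : FO Q) : FO fun M v => P M v ∧ Q M v :=
  (not (imp h (not h'))).congr fun M v => by tauto

lemma or (h : FO P) (h' : FO Q) : FO fun M v => P M v ∨ Q M v :=
  (imp (not h) h').congr fun M v => by tauto

lemma iff (h : FO P) (h' : FO Q) : FO fun M v => (P M v ↔ Q M v) :=
  (and (imp h h') (imp h' h)).congr fun M v => by tauto

lemma ex (h : FO fun M v => R M (fun n => v (n + 1)) (v 0)) : FO fun M v => ∃ x : M, R M v x :=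
  (not (all (R := fun M v x => ¬ R M v x) (not h))).congr fun M v => by simp

lemma rename (h : FO P) (ρ : ℕ → ℕ) : FO fun M v => P M (fun n => v (ρ n)) := by
  induction h generalizing ρ with
  | mem i j => exact mem _ _
  | eq i j => exact eq _ _
  | bot => exact bot
  | imp _ _ h₁ h₂ => exact imp (h₁ ρ) (h₂ ρ)
  | @allCons P _ ih =>
    refine (allCons (ih (fun n => Nat.casesOn n 0 fun m => ρ m + 1))).congr fun M v => ?_
    refine forall_congr' fun x => ?_
    have : scons x (fun n => v (ρ n)) =
        fun n => scons x v (Nat.casesOn n 0 fun m => ρ m + 1) := by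
      funext n; cases n <;> rfl
    rw [this]

/-- A first-order predicate depends on finitely many variables only. -/
lemma exists_support (h : FO P) :
    ∃ n, ∀ (M : TransClass.{u}) (v w : ℕ → M), (∀ i < n, v i = w i) → (P M v ↔ P M w) := by
  induction h with
  | mem i j =>
    refine ⟨max i j + 1, fun M v w h => ?_⟩
    beta_reduce
    rw [h i (by omega), h j (by omega)]
  | eq i j =>
    refine ⟨max i j + 1, fun M v w h => ?_⟩
    beta_reduce
    rw [h i (by omega), h j (by omega)]
  | bot => exact ⟨0, fun _ _ _ _ => Iff.rfl⟩
  | imp _ _ h₁ h₂ =>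
    obtain ⟨n, hn⟩ := h₁
    obtain ⟨m, hm⟩ := h₂
    refine ⟨max n m, fun M v w h => ?_⟩
    beta_reduce
    rw [hn M v w fun i hi => h i (by omega), hm M v w fun i hi => h i (by omega)]
  | allCons _ ih =>
    obtain ⟨n, hn⟩ := ih
    refine ⟨n, fun M v w h => forall_congr' fun x => hn M _ _ fun i hi => ?_⟩
    cases i with
    | zero => rfl
    | succ i => exact h i (by omega)

lemma exists_formula (h : FO P) :
    ∃ φ : setLang.Formula ℕ, ∀ (M : TransClass.{u}) (v : ℕ → M), φ.Realize v ↔ P M v := by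
  induction h with
  | mem i j =>
    exact ⟨Language.Relations.formula₂ (L := setLang) (show setLang.Relations 2 from MemRel.mem)
      (.var i) (.var j), fun M v => Language.Formula.realize_rel₂⟩
  | eq i j =>
    refine ⟨Language.Term.equal (.var i) (.var j), fun M v => ?_⟩
    rw [Language.Formula.realize_equal]
    rfl
  | bot => exact ⟨⊥, fun M v => Iff.rfl⟩
  | imp _ _ h₁ h₂ =>
    obtain ⟨φ, hφ⟩ := h₁
    obtain ⟨ψ, hψ⟩ := h₂
    refine ⟨φ.imp ψ, fun M v => ?_⟩
    rw [Language.Formula.realize_imp, hφ, hψ]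
  | allCons _ ih =>
    obtain ⟨φ, hφ⟩ := ih
    refine ⟨(Language.BoundedFormula.relabel (n := 1)
      (fun n => Nat.casesOn n (Sum.inr 0) fun m => Sum.inl m) φ).all, fun M v => ?_⟩
    refine forall_congr' fun x => ?_
    rw [Language.BoundedFormula.realize_relabel, ← hφ M]
    unfold Language.Formula.Realize
    apply iff_of_eq
    congr 1
    · funext n; cases n <;> rfl
    · exact Subsingleton.elim _ _

lemma exists_var {n : ℕ} (t : setLang.Term (ℕ ⊕ Fin n)) :
    ∃ i, ∀ {M : TransClass.{u}} (v : ℕ → M),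
      t.realize (Sum.elim (fun i => v (n + i)) (fun k : Fin n => v (n - 1 - k))) = v i := by
  rcases t with (⟨i | k⟩ | ⟨f, _⟩)
  · exact ⟨n + i, fun _ => rfl⟩
  · exact ⟨n - 1 - k, fun _ => rfl⟩
  · exact Empty.elim f

/-- The `k`-th of the `n` bound variables of a formula gets the de Bruijn index `n - 1 - k`, as the
last variable is bound innermost, and the free variable `i` gets the index `n + i`. -/
lemma of_boundedFormula {n : ℕ} (φ : setLang.BoundedFormula ℕ n) :
    FO.{u} fun _ v => φ.Realize (fun i => v (n + i)) (fun k => v (n - 1 - k)) := by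
  induction φ with
  | falsum => exact bot
  | @equal n t₁ t₂ =>
    obtain ⟨i, hi⟩ := exists_var t₁
    obtain ⟨j, hj⟩ := exists_var t₂
    exact (eq i j).congr fun M v =>
      iff_of_eq (congrArg₂ (fun a b : M => a = b) (hi v) (hj v))
  | @rel n l r ts =>
    cases r
    obtain ⟨i, hi⟩ := exists_var (ts 0)
    obtain ⟨j, hj⟩ := exists_var (ts 1)
    exact (mem i j).congr fun M v =>
      iff_of_eq (congrArg₂ (fun a b : M => a.1 ∈ b.1) (hi v) (hj v))
  | imp _ _ h₁ h₂ => exact imp h₁ h₂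
  | @all n φ ih =>
    refine (allCons ih).congr fun M v => forall_congr' fun x => ?_
    apply iff_of_eq
    congr 1
    · funext i
      rw [show n + 1 + i = (n + i) + 1 by omega]; rfl
    · funext k
      refine Fin.lastCases ?_ (fun k => ?_) k
      · simp
      · have : n + 1 - 1 - (k : ℕ) = (n - 1 - k) + 1 := by have := k.2; omega
        simp only [this, Fin.snoc_castSucc, Fin.val_castSucc, scons_succ]

/-- Every formula is a first-order predicate of its finitely many variables. -/
lemma of_formula {α : Type*} [Nonempty α] (φ : setLang.Formula α) :
    ∃ (P : ∀ M : TransClass.{u}, (ℕ → M) → Prop) (e : ℕ → α), FO P ∧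
      ∀ (M : TransClass.{u}) (v : α → M), φ.Realize v ↔ P M (fun n => v (e n)) := by
  classical
  let s := φ.freeVarFinset
  let ε : s ≃ Fin s.card := s.equivFin
  let e : ℕ → α := fun n => if h : n < s.card then (ε.symm ⟨n, h⟩).1 else Classical.arbitrary α
  let ψ : setLang.Formula ℕ := φ.restrictFreeVar fun a => (ε a : ℕ)
  refine ⟨_, e, of_boundedFormula ψ, fun M v => ?_⟩
  have h := Language.BoundedFormula.realize_restrictFreeVar (φ := φ)
    (f := fun a => (ε a : ℕ)) (v := fun n => v (e n)) (xs := default) v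
    (fun a => by simp [e])
  rw [Language.Formula.Realize, ← h]
  apply iff_of_eq
  congr 1
  · funext i; simp
  · exact Subsingleton.elim _ _

/-- Elementary embeddings preserve first-order predicates. -/
lemma map_iff (h : FO P) {M N : TransClass.{u}} (j : M ↪ₑ[setLang] N) (v : ℕ → M) :
    P N (fun n => j (v n)) ↔ P M v := by
  obtain ⟨φ, hφ⟩ := h.exists_formula
  rw [← hφ, ← hφ]
  exact j.map_formula φ v

/-- A first-order schema that holds in `V` for all parameters holds for all parameters in every
class into which `V` embeds elementarily. -/
lemma transfer (h : FO P) {N : TransClass.{u}} (j : V.{u} ↪ₑ[setLang] N)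
    (hV : ∀ v, P V v) (v : ℕ → N) : P N v := by
  obtain ⟨n, hn⟩ := h.exists_support
  induction n generalizing P v with
  | zero =>
    exact (hn N _ _ fun i hi => absurd hi (by omega)).1
      ((h.map_iff j (fun _ => toV ∅)).2 (hV _))
  | succ n ih =>
    have := ih (allCons h) (fun v x => hV _) (fun n => v (n + 1)) fun M v w hvw =>
      forall_congr' fun x => hn M _ _ fun i hi => by
        cases i with
        | zero => rfl
        | succ i => exact hvw i (by omega)
    have := this (v 0)
    rwa [scons_head_tail] at this

end FO

/-- A map that preserves first-order predicates is an elementary embedding. -/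
def elementaryOfFO {M N : TransClass.{u}} (k : M → N) (x₀ : M)
    (hk : ∀ P : ∀ M : TransClass.{u}, (ℕ → M) → Prop, FO P →
      ∀ v, P N (fun n => k (v n)) ↔ P M v) : M ↪ₑ[setLang] N where
  toFun := k
  map_formula' := by
    intro n φ x
    obtain ⟨P, e, hP, h⟩ := FO.of_formula.{u} (φ.relabel Fin.val)
    let x' : ℕ → M := fun m => if h : m < n then x ⟨m, h⟩ else x₀
    have key := hk P hP fun i => x' (e i)
    rw [← h M x', ← h N (fun m => k (x' m)),
      Language.Formula.realize_relabel, Language.Formula.realize_relabel] at key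
    simpa [Function.comp_def, x'] using key

/-- A point definable by a first-order predicate with parameters in `X` lies in the hull of `X`. -/
lemma mem_hull_of_FO {N : TransClass.{u}} {X : Set N}
    {P : ∀ M : TransClass.{u}, (ℕ → M) → Prop} (hP : FO P) (w : ℕ → X) {y : N}
    (h : ∀ z, P N (scons z fun n => (w n).1) ↔ z = y) : y ∈ hull N X := by
  obtain ⟨φ, hφ⟩ := hP.exists_formula
  refine Set.definable_iff_exists_formula_sum.2
    ⟨φ.relabel (fun n => Nat.casesOn n (Sum.inr 0) fun m => Sum.inl (w m)), ?_⟩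
  ext v
  simp only [Set.mem_ofPred_eq, Language.Formula.realize_relabel, hφ]
  have : (Sum.elim (fun x : X => (x : N)) v ∘ fun n => Nat.casesOn n (Sum.inr 0)
      fun m => Sum.inl (w m)) = scons (v 0) fun n => (w n).1 := by
    funext n; cases n <;> rfl
  rw [this, h]
  rfl

/-- A point of the hull of `k[M] ∪ {x}` is definable by a first-order predicate of `x` and
parameters in `k[M]`. -/
lemma exists_FO_of_mem_hull {M N : TransClass.{u}} (k : M → N) (x₀ : M) {x y : N}
    (hy : y ∈ hull N (Set.range k ∪ {x})) :
    ∃ (P : ∀ M : TransClass.{u}, (ℕ → M) → Prop) (w : ℕ → M), FO P ∧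
      ∀ z, P N (scons z (scons x fun n => k (w n))) ↔ z = y := by
  classical
  obtain ⟨φ, hφ⟩ := Set.definable_iff_exists_formula_sum.1 hy
  obtain ⟨P, e, hP, h⟩ := FO.of_formula.{u} φ
  have hX : ∀ a : (Set.range k ∪ {x} : Set N), ∃ m : M, a.1 ≠ x → k m = a.1 := by
    rintro ⟨a, ⟨m, rfl⟩ | rfl⟩
    · exact ⟨m, fun _ => rfl⟩
    · exact ⟨x₀, fun h => absurd rfl h⟩
  choose g hg using hX
  refine ⟨_, fun n => Sum.elim g (fun _ => x₀) (e n), hP.rename fun n =>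
    Sum.elim (fun a => if a.1 = x then 1 else n + 2) (fun _ => 0) (e n), fun z => ?_⟩
  have h1 : (fun _ : Fin 1 => z) ∈ {v : Fin 1 → N | v 0 ∈ ({y} : Set N)} ↔ z = y := Iff.rfl
  rw [← h1, hφ, Set.mem_ofPred_eq, h]
  apply iff_of_eq
  congr 1
  funext n
  rcases hn : e n with a | i
  · by_cases ha : a.1 = x
    · simp [ha, scons]
    · simp [ha, scons, hn, hg]
  · rfl

/-! ### Function application and absoluteness -/

open Classical in
/-- The value at `x` of the function coded by the set of ordered pairs `f`, and `∅` if there is no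
such value. -/
noncomputable def app (f x : ZFSet.{u}) : ZFSet.{u} :=
  if h : ∃! y, ZFSet.pair x y ∈ f then h.choose else ∅

lemma app_eq {f x y : ZFSet.{u}} (h : ZFSet.pair x y ∈ f)
    (h' : ∀ z, ZFSet.pair x z ∈ f → z = y) : app f x = y := by
  have hu : ∃! y, ZFSet.pair x y ∈ f := ⟨y, h, h'⟩
  rw [app, dif_pos hu]
  exact h' _ hu.choose_spec.1

lemma app_eq_empty {f x : ZFSet.{u}} (h : ¬ ∃! y, ZFSet.pair x y ∈ f) : app f x = ∅ :=
  dif_neg h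

/-- The graph of `F` on the set `a`. -/
noncomputable def graph (a : ZFSet.{u}) (F : ZFSet.{u} → ZFSet.{u}) : ZFSet.{u} :=
  ZFSet.range fun x : a => ZFSet.pair x.1 (F x.1)

lemma pair_mem_graph {a : ZFSet.{u}} {F : ZFSet.{u} → ZFSet.{u}} {x y : ZFSet.{u}} :
    ZFSet.pair x y ∈ graph a F ↔ x ∈ a ∧ y = F x := by
  simp only [graph, ZFSet.mem_range, ZFSet.pair_inj, Subtype.exists]
  constructor
  · rintro ⟨x, hx, rfl, rfl⟩; exact ⟨hx, rfl⟩
  · rintro ⟨hx, rfl⟩; exact ⟨x, hx, rfl, rfl⟩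

lemma app_graph {a : ZFSet.{u}} {F : ZFSet.{u} → ZFSet.{u}} {x : ZFSet.{u}} (hx : x ∈ a) :
    app (graph a F) x = F x :=
  app_eq (pair_mem_graph.2 ⟨hx, rfl⟩) fun _ h => (pair_mem_graph.1 h).2

namespace TransClass

variable (M : TransClass.{u})

lemma mem_of_mem {M : TransClass.{u}} (x : M) {y : ZFSet.{u}} (h : y ∈ x.1) : y ∈ M.carrier :=
  M.transitive _ x.2 _ h

lemma left_mem_of_pair_mem {M : TransClass.{u}} {x y : ZFSet.{u}}
    (h : ZFSet.pair x y ∈ M.carrier) : x ∈ M.carrier :=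
  M.transitive _ (M.transitive _ h {x} (by simp [ZFSet.pair])) _ (by simp)

lemma right_mem_of_pair_mem {M : TransClass.{u}} {x y : ZFSet.{u}}
    (h : ZFSet.pair x y ∈ M.carrier) : y ∈ M.carrier :=
  M.transitive _ (M.transitive _ h {x, y} (by simp [ZFSet.pair])) _ (by simp)

lemma empty_mem {M : TransClass.{u}} {x : ZFSet.{u}} (h : x ∈ M.carrier) : ∅ ∈ M.carrier := by
  induction x using ZFSet.inductionOn with
  | h x ih =>
    rcases ZFSet.eq_empty_or_nonempty x with rfl | ⟨y, hy⟩
    · exact h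
    · exact ih y hy (M.transitive _ h _ hy)

lemma app_mem {M : TransClass.{u}} (f x : M) : app f.1 x.1 ∈ M.carrier := by
  by_cases h : ∃! y, ZFSet.pair x.1 y ∈ f.1
  · obtain ⟨y, hy, hy'⟩ := h
    rw [app_eq hy hy']
    exact right_mem_of_pair_mem (mem_of_mem f hy)
  · rw [app_eq_empty h]
    exact empty_mem x.2

/-- Function application in a transitive class. -/
noncomputable def app (f x : M) : M := ⟨KetonenUniv.app f.1 x.1, app_mem f x⟩

lemma ext_iff {M : TransClass.{u}} {x y : M} : x = y ↔ ∀ t : M, t.1 ∈ x.1 ↔ t.1 ∈ y.1 := by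
  refine ⟨fun h _ => by rw [h], fun h =>
    Subtype.ext (ZFSet.ext fun t => ⟨fun ht => ?_, fun ht => ?_⟩)⟩
  · exact (h ⟨t, mem_of_mem x ht⟩).1 ht
  · exact (h ⟨t, mem_of_mem y ht⟩).2 ht

lemma forall_mem_iff {M : TransClass.{u}} (x : M) {p : ZFSet.{u} → Prop} :
    (∀ t ∈ x.1, p t) ↔ ∀ t : M, t.1 ∈ x.1 → p t.1 :=
  ⟨fun h t ht => h t.1 ht, fun h t ht => h ⟨t, mem_of_mem x ht⟩ ht⟩

lemma exists_mem_iff {M : TransClass.{u}} (x : M) {p : ZFSet.{u} → Prop} :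
    (∃ t ∈ x.1, p t) ↔ ∃ t : M, t.1 ∈ x.1 ∧ p t.1 :=
  ⟨fun ⟨t, h, h'⟩ => ⟨⟨t, mem_of_mem x h⟩, h, h'⟩, fun ⟨t, h, h'⟩ => ⟨t.1, h, h'⟩⟩

end TransClass

open TransClass

/-- The sequence-completeness clause of `IsCountablyCompleteIn`, with the index set `ω` replaced by
a parameter `o`. -/
def IsCompleteIn (M : TransClass.{u}) (o A U : ZFSet.{u}) : Prop :=
  ∀ f ∈ M.carrier, ZFSet.IsFunc o U f →
    ZFSet.sep (fun a => ∀ n X : ZFSet.{u}, ZFSet.pair n X ∈ f → a ∈ X) A ∈ U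

namespace FO

variable {P : ∀ M : TransClass.{u}, (ℕ → M) → Prop}
  {R : ∀ M : TransClass.{u}, (ℕ → M) → M → Prop}

lemma subset (i j : ℕ) : FO.{u} fun _ v => (v i).1 ⊆ (v j).1 :=
  (all (R := fun _ v x => x.1 ∈ (v i).1 → x.1 ∈ (v j).1) (.imp (.mem _ _) (.mem _ _))).congr
    fun _ v => forall_mem_iff (v i)

lemma eq_empty (i : ℕ) : FO.{u} fun _ v => (v i).1 = ∅ :=
  (all (R := fun _ v x => x.1 ∉ (v i).1) (.not (.mem _ _))).congr fun _ v =>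
    (ZFSet.eq_empty _).trans (forall_mem_iff (v i) (p := fun _ => False))

lemma eq_upair (i j k : ℕ) : FO.{u} fun _ v => (v i).1 = {(v j).1, (v k).1} :=
  (all (R := fun _ v x => x.1 ∈ (v i).1 ↔ x = v j ∨ x = v k)
    (.iff (.mem _ _) (.or (.eq _ _) (.eq _ _)))).congr fun M v => by
    rw [ZFSet.ext_iff]
    simp only [ZFSet.mem_pair]
    refine ⟨fun h t => by rw [h, Subtype.ext_iff, Subtype.ext_iff], fun h t =>
      ⟨fun ht => ?_, ?_⟩⟩
    · simpa [Subtype.ext_iff] using (h ⟨t, mem_of_mem _ ht⟩).1 ht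
    · rintro (rfl | rfl)
      · exact (h (v j)).2 (.inl rfl)
      · exact (h (v k)).2 (.inr rfl)

lemma eq_insert (i j k : ℕ) : FO.{u} fun _ v => (v i).1 = insert (v j).1 (v k).1 :=
  (all (R := fun _ v x => x.1 ∈ (v i).1 ↔ x = v j ∨ x.1 ∈ (v k).1)
    (.iff (.mem _ _) (.or (.eq _ _) (.mem _ _)))).congr fun M v => by
    rw [ZFSet.ext_iff]
    simp only [ZFSet.mem_insert_iff]
    refine ⟨fun h t => by rw [h, Subtype.ext_iff], fun h t => ⟨fun ht => ?_, ?_⟩⟩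
    · simpa [Subtype.ext_iff] using (h ⟨t, mem_of_mem _ ht⟩).1 ht
    · rintro (rfl | ht)
      · exact (h (v j)).2 (.inl rfl)
      · exact (h ⟨t, mem_of_mem _ ht⟩).2 (.inr ht)

lemma eq_pair (i j k : ℕ) : FO.{u} fun _ v => (v i).1 = ZFSet.pair (v j).1 (v k).1 :=
  (ex (R := fun M v b => ∃ a : M, a.1 = {(v j).1, (v j).1} ∧ b.1 = {(v j).1, (v k).1} ∧
      (v i).1 = {a.1, b.1})
    (.ex (.and (.eq_upair _ _ _) (.and (.eq_upair _ _ _) (.eq_upair _ _ _))))).congr fun M v => by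
    constructor
    · intro h
      refine ⟨⟨{(v j).1, (v k).1}, mem_of_mem (v i) ?_⟩, ⟨{(v j).1, (v j).1}, mem_of_mem (v i) ?_⟩,
        rfl, rfl, ?_⟩
      · simp [h, ZFSet.pair]
      · simp [h, ZFSet.pair]
      · simp [h, ZFSet.pair]
    · rintro ⟨b, a, ha, hb, h⟩
      rw [h, hb, ha, ZFSet.pair, ZFSet.pair_eq_singleton]

lemma pair_mem (i j k : ℕ) : FO.{u} fun _ v => ZFSet.pair (v i).1 (v j).1 ∈ (v k).1 :=
  (ex (R := fun _ v p => p.1 = ZFSet.pair (v i).1 (v j).1 ∧ p.1 ∈ (v k).1)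
    (.and (.eq_pair _ _ _) (.mem _ _))).congr fun M v => by
    constructor
    · exact fun h => ⟨⟨_, mem_of_mem _ h⟩, rfl, h⟩
    · rintro ⟨p, hp, h⟩; rwa [← hp]

lemma eq_app (i j k : ℕ) : FO.{u} fun M v => v i = M.app (v j) (v k) := by
  let U : ∀ M : TransClass.{u}, (ℕ → M) → M → Prop := fun M v y =>
    ZFSet.pair (v k).1 y.1 ∈ (v j).1 ∧ ∀ z : M, ZFSet.pair (v k).1 z.1 ∈ (v j).1 → z = y
  have hU : FO fun M v => U M (fun n => v (n + 1)) (v 0) :=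
    .and (.pair_mem _ _ _) (.all (.imp (.pair_mem _ _ _) (.eq _ _)))
  have hU' : ∀ (M : TransClass.{u}) v (y : M), U M v y ↔ ZFSet.pair (v k).1 y.1 ∈ (v j).1 ∧
      ∀ z, ZFSet.pair (v k).1 z ∈ (v j).1 → z = y.1 := fun M v y => and_congr_right fun _ =>
    ⟨fun h z hz => congrArg Subtype.val (h ⟨z, right_mem_of_pair_mem (mem_of_mem _ hz)⟩ hz),
      fun h z hz => Subtype.ext (h _ hz)⟩
  refine (or (ex (R := fun M v y => U M v y ∧ y = v i) (.and hU (.eq _ _)))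
    (.and (.not (.ex hU)) (.eq_empty i))).congr fun M v => ?_
  simp only [hU', exists_eq_right]
  rw [Subtype.ext_iff]
  change (v i).1 = KetonenUniv.app _ _ ↔ _
  constructor
  · intro h
    by_cases hu : ∃! y, ZFSet.pair (v k).1 y ∈ (v j).1
    · obtain ⟨y, hy, hy'⟩ := hu
      rw [app_eq hy hy'] at h
      subst h
      exact .inl ⟨hy, hy'⟩
    · refine .inr ⟨fun ⟨y, hy⟩ => hu ⟨y.1, hy⟩, ?_⟩
      rw [h, app_eq_empty hu]
  · rintro (⟨h, h'⟩ | ⟨h, h'⟩)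
    · exact (app_eq h h').symm
    · rw [h', app_eq_empty]
      rintro ⟨y, hy⟩
      exact h ⟨⟨y, right_mem_of_pair_mem (mem_of_mem _ hy.1)⟩, hy⟩

lemma comp_app (h : FO fun M v => R M (fun n => v (n + 1)) (v 0)) (i j : ℕ) :
    FO fun M v => R M v (M.app (v i) (v j)) :=
  (ex (R := fun M v x => x = M.app (v i) (v j) ∧ R M v x)
    (.and (.eq_app 0 (i + 1) (j + 1)) h)).congr fun M v => by simp

/-- Simultaneous substitution of functions with first-order graphs. -/
lemma subst (h : FO P) (T : ∀ M : TransClass.{u}, (ℕ → M) → ℕ → M)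
    (hT : ∀ i, FO fun M v => v 0 = T M (fun n => v (n + 1)) i) : FO fun M v => P M (T M v) := by
  induction h generalizing T with
  | mem i j =>
    refine (ex (R := fun M v x => ∃ y : M, x = T M v i ∧ y = T M v j ∧ x.1 ∈ y.1)
      (.ex (.and ((hT i).rename fun n => Nat.casesOn n 1 fun m => m + 2)
        (.and ((hT j).rename fun n => Nat.casesOn n 0 fun m => m + 2) (.mem 1 0))))).congr
      fun M v => by simp
  | eq i j =>
    refine (ex (R := fun M v x => x = T M v i ∧ x = T M v j) (.and (hT i) (hT j))).congr
      fun M v => by simp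
  | bot => exact bot
  | imp _ _ h₁ h₂ => exact imp (h₁ T hT) (h₂ T hT)
  | @allCons P _ ih =>
    have := ih (fun M v => scons (v 0) (T M fun n => v (n + 1))) fun i => by
      cases i with
      | zero => exact .eq 0 1
      | succ i => exact (hT i).rename fun n => Nat.casesOn n 0 fun m => m + 2
    exact all (R := fun M v x => P M (scons x (T M v))) this

lemma subst₁ (h : FO P) (i k : ℕ) : FO fun M v => P M (scons (v i) fun n => v (n + k)) :=
  (h.rename fun n => Nat.casesOn n i fun n => n + k).congr fun M v => iff_of_eq <| by
    congr 1; funext n; rcases n with _ | n <;> rfl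

lemma subst₂ (h : FO P) (i j k : ℕ) :
    FO fun M v => P M (scons (v i) (scons (v j) fun n => v (n + k))) :=
  (h.rename fun n => Nat.casesOn n i fun n => Nat.casesOn n j fun n => n + k).congr
    fun M v => iff_of_eq <| by
    congr 1; funext n; rcases n with _ | _ | n <;> rfl

lemma app_mem_app (i j k l : ℕ) :
    FO.{u} fun _ v => app (v i).1 (v j).1 ∈ app (v k).1 (v l).1 :=
  comp_app (R := fun _ v x => x.1 ∈ app (v k).1 (v l).1)
    (comp_app (R := fun _ v y => (v 0).1 ∈ y.1) (.mem 1 0) (k + 1) (l + 1)) i j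

lemma inter_mem (i j k : ℕ) : FO.{u} fun _ v => (v i).1 ∩ (v j).1 ∈ (v k).1 :=
  (ex (R := fun M v z => z.1 ∈ (v k).1 ∧ ∀ t : M, t.1 ∈ z.1 ↔ t.1 ∈ (v i).1 ∧ t.1 ∈ (v j).1)
    (.and (.mem _ _) (.all (.iff (.mem _ _) (.and (.mem _ _) (.mem _ _)))))).congr fun M v => by
    constructor
    · exact fun h => ⟨⟨_, mem_of_mem _ h⟩, h, fun t => ZFSet.mem_inter⟩
    · rintro ⟨z, hz, h⟩
      convert hz
      refine ZFSet.ext fun t => ⟨fun ht => ?_, fun ht => ?_⟩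
      · exact (h ⟨t, mem_of_mem (v i) (ZFSet.mem_inter.1 ht).1⟩).2 (ZFSet.mem_inter.1 ht)
      · exact ZFSet.mem_inter.2 ((h ⟨t, mem_of_mem z ht⟩).1 ht)

lemma sdiff_mem (i j k : ℕ) : FO.{u} fun _ v => (v i).1 \ (v j).1 ∈ (v k).1 :=
  (ex (R := fun M v z => z.1 ∈ (v k).1 ∧ ∀ t : M, t.1 ∈ z.1 ↔ t.1 ∈ (v i).1 ∧ t.1 ∉ (v j).1)
    (.and (.mem _ _) (.all (.iff (.mem _ _) (.and (.mem _ _) (.not (.mem _ _))))))).congr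
    fun M v => by
    constructor
    · exact fun h => ⟨⟨_, mem_of_mem _ h⟩, h, fun t => ZFSet.mem_sdiff⟩
    · rintro ⟨z, hz, h⟩
      convert hz
      refine ZFSet.ext fun t => ⟨fun ht => ?_, fun ht => ?_⟩
      · exact (h ⟨t, mem_of_mem (v i) (ZFSet.mem_sdiff.1 ht).1⟩).2 (ZFSet.mem_sdiff.1 ht)
      · exact ZFSet.mem_sdiff.2 ((h ⟨t, mem_of_mem z ht⟩).1 ht)

lemma isUltrafilterIn (i j : ℕ) : FO.{u} fun M v => IsUltrafilterIn M (v i).1 (v j).1 := by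
  have h : FO.{u} fun M v => (∀ x : M, x.1 ∈ (v j).1 → x.1 ⊆ (v i).1) ∧ (v i).1 ∈ (v j).1 ∧
      (¬ ∃ x : M, x.1 ∈ (v j).1 ∧ x.1 = ∅) ∧
      (∀ x : M, x.1 ∈ (v j).1 → ∀ y : M, x.1 ⊆ y.1 → y.1 ⊆ (v i).1 → y.1 ∈ (v j).1) ∧
      (∀ x : M, x.1 ∈ (v j).1 → ∀ y : M, y.1 ∈ (v j).1 → x.1 ∩ y.1 ∈ (v j).1) ∧
      ∀ x : M, x.1 ⊆ (v i).1 → x.1 ∈ (v j).1 ∨ (v i).1 \ x.1 ∈ (v j).1 :=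
    .and (.all (.imp (.mem _ _) (.subset _ _))) <| .and (.mem _ _) <|
    .and (.not (.ex (.and (.mem _ _) (.eq_empty _)))) <|
    .and (.all (.imp (.mem _ _) (.all (.imp (.subset _ _) (.imp (.subset _ _) (.mem _ _)))))) <|
    .and (.all (.imp (.mem _ _) (.all (.imp (.mem _ _) (.inter_mem _ _ _))))) <|
    .all (.imp (.subset _ _) (.or (.mem _ _) (.sdiff_mem _ _ _)))
  exact h.congr fun M v => by
    constructor
    · intro h
      refine ⟨fun x => h.subset x.1, h.whole_mem, fun ⟨e, he, he'⟩ => h.empty_notMem (he' ▸ he),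
        fun x hx y => h.upward x.1 hx y.1 y.2, fun x hx y hy => h.inter_mem x.1 hx y.1 hy,
        fun x => h.ultra x.1 x.2⟩
    · rintro ⟨h1, h2, h3, h4, h5, h6⟩
      have m : ∀ {x}, x ∈ (v j).1 → x ∈ M.carrier := fun h => mem_of_mem _ h
      exact ⟨(v j).2, fun x hx => h1 ⟨x, m hx⟩ hx, h2, fun h => h3 ⟨⟨∅, m h⟩, h, rfl⟩,
        fun x hx y hy => h4 ⟨x, m hx⟩ hx ⟨y, hy⟩, fun x hx y hy => h5 ⟨x, m hx⟩ hx ⟨y, m hy⟩ hy,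
        fun x hx => h6 ⟨x, hx⟩⟩

lemma isCompleteIn (k i j : ℕ) :
    FO.{u} fun M v => IsCompleteIn M (v k).1 (v i).1 (v j).1 := by
  have h : FO.{u} fun M v => ∀ f : M, ((∀ p : M, p.1 ∈ f.1 → ∃ a : M, a.1 ∈ (v k).1 ∧
      ∃ b : M, b.1 ∈ (v j).1 ∧ p.1 = ZFSet.pair a.1 b.1) ∧
      (∀ a : M, a.1 ∈ (v k).1 → ∃ b : M, ZFSet.pair a.1 b.1 ∈ f.1 ∧
        ∀ c : M, ZFSet.pair a.1 c.1 ∈ f.1 → c = b)) →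
      ∃ z : M, z.1 ∈ (v j).1 ∧ ∀ t : M, t.1 ∈ z.1 ↔ t.1 ∈ (v i).1 ∧
        ∀ n X : M, ZFSet.pair n.1 X.1 ∈ f.1 → t.1 ∈ X.1 :=
    .all (.imp (.and (.all (.imp (.mem _ _) (.ex (.and (.mem _ _) (.ex (.and (.mem _ _)
      (.eq_pair _ _ _))))))) (.all (.imp (.mem _ _) (.ex (.and (.pair_mem _ _ _)
      (.all (.imp (.pair_mem _ _ _) (.eq _ _))))))))
      (.ex (.and (.mem _ _) (.all (.iff (.mem _ _) (.and (.mem _ _)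
      (.all (.all (.imp (.pair_mem _ _ _) (.mem _ _))))))))))
  exact h.congr fun M v => by
    unfold IsCompleteIn
    rw [Subtype.forall']
    refine forall_congr' fun f => imp_congr ?_ ?_
    · refine and_congr ?_ ?_
      · refine (forall_mem_iff f).trans (forall_congr' fun t => imp_congr_right fun _ => ?_)
        rw [ZFSet.mem_prod, exists_mem_iff (v k)]
        refine exists_congr fun a => and_congr_right fun _ => exists_mem_iff (v j)
      · refine (forall_mem_iff (v k)).trans (forall_congr' fun t => imp_congr_right fun _ => ?_)
        constructor
        · rintro ⟨w, hw, hw'⟩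
          exact ⟨⟨w, right_mem_of_pair_mem (mem_of_mem f hw)⟩, hw,
            fun z hz => Subtype.ext (hw' z.1 hz)⟩
        · rintro ⟨w, hw, hw'⟩
          exact ⟨w.1, hw, fun z hz => congrArg Subtype.val
            (hw' ⟨z, right_mem_of_pair_mem (mem_of_mem f hz)⟩ hz)⟩
    · have key : ∀ t : ZFSet.{u}, (∀ n X, ZFSet.pair n X ∈ f.1 → t ∈ X) ↔
          ∀ n X : M, ZFSet.pair n.1 X.1 ∈ f.1 → t ∈ X.1 := fun t =>
        ⟨fun h n X => h n.1 X.1, fun h n X hp =>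
          h ⟨n, left_mem_of_pair_mem (mem_of_mem f hp)⟩
            ⟨X, right_mem_of_pair_mem (mem_of_mem f hp)⟩ hp⟩
      constructor
      · exact fun h => ⟨⟨_, mem_of_mem _ h⟩, h, fun t => by rw [ZFSet.mem_sep, key]⟩
      · rintro ⟨z, hz, h⟩
        convert hz
        refine ZFSet.ext fun t => ?_
        rw [ZFSet.mem_sep, key]
        exact ⟨fun ht => (h ⟨t, mem_of_mem (v i) ht.1⟩).2 ht, fun ht =>
          (h ⟨t, mem_of_mem z ht⟩).1 ht⟩

end FO

/-! ### Closure properties of elementary targets of the universe -/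

section InnerModel

variable {M N : TransClass.{u}} {P : ∀ M : TransClass.{u}, (ℕ → M) → Prop}

instance : Inhabited V.{u} := ⟨toV ∅⟩

@[simp] lemma toV_val (x : ZFSet.{u}) : (toV x).1 = x := rfl

@[simp] lemma toV_coe (x : V.{u}) : toV x.1 = x := rfl

lemma V_app_graph (a : ZFSet.{u}) (F : ZFSet.{u} → ZFSet.{u}) {x : V.{u}} (hx : x.1 ∈ a) :
    (V.app (toV (graph a F)) x).1 = F x.1 := by
  change app (graph a F) x.1 = F x.1
  exact app_graph hx

lemma mem_map_iff (k : M ↪ₑ[setLang] N) {x y : M} : (k x).1 ∈ (k y).1 ↔ x.1 ∈ y.1 :=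
  (FO.mem 0 1).map_iff k (scons x fun _ => y)

lemma subset_map_iff (k : M ↪ₑ[setLang] N) {x y : M} : (k x).1 ⊆ (k y).1 ↔ x.1 ⊆ y.1 :=
  (FO.subset 0 1).map_iff k (scons x fun _ => y)

lemma map_app (k : M ↪ₑ[setLang] N) (f x : M) : k (M.app f x) = N.app (k f) (k x) :=
  ((FO.eq_app 0 1 2).map_iff k (scons (M.app f x) (scons f fun _ => x))).2 rfl

/-- The schema of replacement and choice: a first-order relation that is total on a subset of `a`
has a choice function in the class. -/
lemma exists_choice (j : V.{u} ↪ₑ[setLang] M) (hP : FO P) (v : ℕ → M) (a : M) :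
    ∃ f : M, ∀ x : M, x.1 ∈ a.1 → (∃ y, P M (scons y (scons x v))) →
      P M (scons (M.app f x) (scons x v)) := by
  have h : FO.{u} fun M v => ∀ a : M, ∃ f : M, ∀ x : M, x.1 ∈ a.1 →
      (∃ y, P M (scons y (scons x v))) → P M (scons (M.app f x) (scons x v)) :=
    .all (.ex (.all (.imp (.mem _ _) (.imp (.ex (hP.subst₂ 0 1 4))
      (.comp_app (R := fun M v y => P M (scons y (scons (v 0) fun n => v (n + 3))))
        (hP.subst₂ 0 1 4) 1 0)))))
  refine h.transfer j (fun v a => ?_) v a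
  choose! F hF using fun x (h : ∃ y, P V (scons y (scons (toV x) v))) => h
  refine ⟨toV (graph a.1 fun x => (F x).1), fun x hx hy => ?_⟩
  have : V.app (toV (graph a.1 fun x => (F x).1)) x = F x.1 :=
    Subtype.ext (V_app_graph a.1 (fun x => (F x).1) hx)
  rw [this]
  exact hF x.1 hy

/-- The schema of separation. -/
lemma exists_sep (j : V.{u} ↪ₑ[setLang] M) (hP : FO P) (v : ℕ → M) (a : M) :
    ∃ b : M, ∀ x : M, x.1 ∈ b.1 ↔ x.1 ∈ a.1 ∧ P M (scons x v) := by
  have h : FO.{u} fun M v => ∀ a : M, ∃ b : M, ∀ x : M, x.1 ∈ b.1 ↔ x.1 ∈ a.1 ∧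
      P M (scons x v) :=
    .all (.ex (.all (.iff (.mem _ _) (.and (.mem _ _) (hP.subst₁ 0 3)))))
  refine h.transfer j (fun v a => ⟨toV (ZFSet.sep (fun x => P V (scons (toV x) v)) a.1),
    fun x => ?_⟩) v a
  rw [toV_val, ZFSet.mem_sep, toV_coe]

lemma pair_mem_carrier (j : V.{u} ↪ₑ[setLang] M) (x y : M) :
    ZFSet.pair x.1 y.1 ∈ M.carrier := by
  have h : FO.{u} fun M v => ∀ x y : M, ∃ z : M, z.1 = ZFSet.pair x.1 y.1 :=
    .all (.all (.ex (.eq_pair _ _ _)))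
  obtain ⟨z, hz⟩ := h.transfer j (fun v x y => ⟨toV _, rfl⟩) (fun _ => x) x y
  exact hz ▸ z.2

lemma exists_powerset (j : V.{u} ↪ₑ[setLang] M) (x : M) :
    ∃ y : M, ∀ z : M, z.1 ∈ y.1 ↔ z.1 ⊆ x.1 := by
  have h : FO.{u} fun M v => ∀ x : M, ∃ y : M, ∀ z : M, z.1 ∈ y.1 ↔ z.1 ⊆ x.1 :=
    .all (.ex (.all (.iff (.mem _ _) (.subset _ _))))
  exact h.transfer j (fun v x => ⟨toV x.1.powerset, fun z => ZFSet.mem_powerset⟩)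
    (fun _ => x) x

/-- Every point of an elementary target of the universe belongs to a point of the range. -/
lemma exists_mem_map (j : V.{u} ↪ₑ[setLang] M) (x : M) : ∃ a, x.1 ∈ (j a).1 := by
  obtain ⟨x, hx⟩ := x
  induction x using ZFSet.inductionOn with
  | h x ih =>
    have : ∀ t : x, ∃ a, t.1 ∈ (j a).1 := fun t => ih t.1 t.2 (M.transitive _ hx _ t.2)
    choose a ha using this
    refine ⟨toV (ZFSet.iUnion fun t => (a t).1).powerset, ?_⟩
    have h : FO.{u} fun M v => ∀ z : M, z.1 ⊆ (v 0).1 → z.1 ∈ (v 1).1 :=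
      .all (.imp (.subset _ _) (.mem _ _))
    refine (h.map_iff j (scons (toV (ZFSet.iUnion fun t => (a t).1))
      fun _ => toV (ZFSet.iUnion fun t => (a t).1).powerset)).2
      (fun z hz => ZFSet.mem_powerset.2 hz) ⟨x, hx⟩ fun t ht => ?_
    refine (subset_map_iff j (x := a ⟨t, ht⟩)).2 (fun s hs => ?_) (ha ⟨t, ht⟩)
    exact ZFSet.mem_iUnion.2 ⟨_, hs⟩

/-- The points of the hull of `k[M] ∪ {x}` are the values at `x` of the functions in `k[M]`. -/
lemma exists_eq_app_of_mem_hull (j : V.{u} ↪ₑ[setLang] M) (k : M ↪ₑ[setLang] N) {x y : N}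
    (hy : y ∈ hull N (Set.range k ∪ {x})) : ∃ f : M, y = N.app (k f) x := by
  obtain ⟨P, w, hP, hw⟩ := exists_FO_of_mem_hull k (j (toV ∅)) hy
  obtain ⟨a, ha⟩ := exists_mem_map (k.comp j) x
  obtain ⟨f, hf⟩ := exists_choice j hP w (j a)
  have h : FO.{u} fun M v => ∀ x : M, x.1 ∈ (v 1).1 → (∃ y, P M (scons y (scons x fun n =>
      v (n + 2)))) → P M (scons (M.app (v 0) x) (scons x fun n => v (n + 2))) :=
    .all (.imp (.mem _ _) (.imp (.ex (hP.subst₂ 0 1 4))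
      (.comp_app (R := fun M v y => P M (scons y (scons (v 0) fun n => v (n + 3))))
        (hP.subst₂ 0 1 4) 1 0)))
  have key := (h.map_iff k (scons f (scons (j a) w))).2 hf x ha ⟨y, (hw y).2 rfl⟩
  exact ⟨f, ((hw _).1 key).symm⟩

lemma app_mem_hull (k : M ↪ₑ[setLang] N) (f : M) (x : N) :
    N.app (k f) x ∈ hull N (Set.range k ∪ {x}) :=
  mem_hull_of_FO (FO.eq_app 0 1 2)
    (scons ⟨k f, .inl ⟨f, rfl⟩⟩ fun _ => ⟨x, .inr rfl⟩) fun _ => Iff.rfl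

lemma hull_eq_univ_iff (j : V.{u} ↪ₑ[setLang] M) (k : M ↪ₑ[setLang] N) {x : N} :
    hull N (Set.range k ∪ {x}) = Set.univ ↔ ∀ y, ∃ f : M, y = N.app (k f) x := by
  refine ⟨fun h y => exists_eq_app_of_mem_hull j k (h ▸ Set.mem_univ y), fun h => ?_⟩
  refine Set.eq_univ_of_forall fun y => ?_
  obtain ⟨f, rfl⟩ := h y
  exact app_mem_hull k f x

lemma isUltrapower_iff (j : V.{u} ↪ₑ[setLang] M) (k : M ↪ₑ[setLang] N) :
    IsUltrapower k ↔ ∃ x, ∀ y, ∃ f : M, y = N.app (k f) x :=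
  exists_congr fun _ => hull_eq_univ_iff j k

/-- A composition of ultrapower embeddings is an ultrapower embedding: the pair of the two
generators generates. -/
lemma IsUltrapower.comp {j : V.{u} ↪ₑ[setLang] M} {k : M ↪ₑ[setLang] N} (hj : IsUltrapower j)
    (hk : IsUltrapower k) : IsUltrapower (k.comp j) := by
  obtain ⟨x, hx⟩ := (isUltrapower_iff (.refl setLang V) j).1 hj
  obtain ⟨y, hy⟩ := (isUltrapower_iff j k).1 hk
  refine ⟨⟨_, pair_mem_carrier (k.comp j) (k x) y⟩, Set.eq_univ_of_forall fun z => ?_⟩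
  obtain ⟨f, rfl⟩ := hy z
  obtain ⟨g, rfl⟩ := hx f
  have h : FO.{u} fun M v => ∃ p q : M, (v 2).1 = ZFSet.pair p.1 q.1 ∧
      ∃ r : M, r = M.app (v 1) p ∧ v 0 = M.app r q :=
    .ex (.ex (.and (.eq_pair _ _ _) (.ex (.and (.eq_app _ _ _) (.eq_app _ _ _)))))
  refine mem_hull_of_FO h (scons ⟨k.comp j g, .inl ⟨g, rfl⟩⟩ fun _ => ⟨_, .inr rfl⟩) fun z => ?_
  constructor
  · rintro ⟨p, q, hpq, r, rfl, hz⟩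
    obtain ⟨h1, h2⟩ := ZFSet.pair_inj.1 hpq
    rw [map_app, Subtype.ext h1, Subtype.ext h2]
    exact hz
  · rintro rfl
    refine ⟨k x, y, rfl, _, rfl, ?_⟩
    rw [map_app]
    rfl

/-! ### Fixing the natural numbers -/

lemma map_nat (k : M ↪ₑ[setLang] N) (n : ℕ) {x : M} (hx : x.1 = (n : Ordinal.{u}).toZFSet) :
    (k x).1 = (n : Ordinal.{u}).toZFSet := by
  induction n generalizing x with
  | zero =>
    rw [Nat.cast_zero, Ordinal.toZFSet_zero] at *
    exact ((FO.eq_empty 0).map_iff k fun _ => x).2 hx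
  | succ n ih =>
    rw [Nat.cast_succ, Ordinal.toZFSet_add_one] at *
    have hy : (n : Ordinal.{u}).toZFSet ∈ x.1 := hx ▸ ZFSet.mem_insert _ _
    have := ((FO.eq_insert 0 1 1).map_iff k (scons x fun _ => ⟨_, mem_of_mem x hy⟩)).2 hx
    rw [← ih (x := ⟨_, mem_of_mem x hy⟩) rfl]
    exact this

lemma mem_omega0_iff {x : ZFSet.{u}} :
    x ∈ Ordinal.omega0.{u}.toZFSet ↔ ∃ n : ℕ, x = (n : Ordinal.{u}).toZFSet := by
  rw [Ordinal.mem_toZFSet_iff]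
  constructor
  · rintro ⟨a, ha, rfl⟩
    obtain ⟨n, rfl⟩ := Ordinal.lt_omega0.1 ha
    exact ⟨n, rfl⟩
  · rintro ⟨n, rfl⟩
    exact ⟨n, Ordinal.natCast_lt_omega0 n, rfl⟩

lemma map_of_mem_omega0 (k : M ↪ₑ[setLang] N) {x : M} (hx : x.1 ∈ Ordinal.omega0.{u}.toZFSet) :
    (k x).1 = x.1 := by
  obtain ⟨n, hn⟩ := mem_omega0_iff.1 hx
  rw [map_nat k n hn, hn]

lemma map_omega0 (k : M ↪ₑ[setLang] N) {o : M} (ho : o.1 = Ordinal.omega0.{u}.toZFSet) :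
    (k o).1 = Ordinal.omega0.{u}.toZFSet := by
  have h : FO.{u} fun M v => ∀ x : M, x.1 ∈ (v 0).1 → x.1 = ∅ ∨
      ∃ y : M, y.1 ∈ (v 0).1 ∧ x.1 = insert y.1 y.1 :=
    .all (.imp (.mem _ _) (.or (.eq_empty _) (.ex (.and (.mem _ _) (.eq_insert _ _ _)))))
  have hM : ∀ x : M, x.1 ∈ o.1 → x.1 = ∅ ∨ ∃ y : M, y.1 ∈ o.1 ∧ x.1 = insert y.1 y.1 := by
    intro x hx
    obtain ⟨n, hn⟩ := mem_omega0_iff.1 (ho ▸ hx)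
    rcases n with _ | n
    · left; simpa using hn
    · right
      rw [Nat.cast_succ, Ordinal.toZFSet_add_one] at hn
      have hy : (n : Ordinal.{u}).toZFSet ∈ x.1 := hn ▸ ZFSet.mem_insert _ _
      exact ⟨⟨_, mem_of_mem x hy⟩, ho ▸ mem_omega0_iff.2 ⟨n, rfl⟩, hn⟩
  have hN := (h.map_iff k fun _ => o).2 hM
  refine ZFSet.ext fun x => ⟨fun hx => ?_, fun hx => ?_⟩
  · induction x using ZFSet.inductionOn with
    | h x ih =>
      rcases hN ⟨x, mem_of_mem _ hx⟩ hx with h0 | ⟨y, hy, h1⟩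
      · exact mem_omega0_iff.2 ⟨0, by simpa using h0⟩
      · obtain ⟨n, hn⟩ := mem_omega0_iff.1
          (ih y.1 ((show x = _ from h1) ▸ ZFSet.mem_insert _ _) hy)
        refine mem_omega0_iff.2 ⟨n + 1, ?_⟩
        rw [Nat.cast_succ, Ordinal.toZFSet_add_one, ← hn]
        exact h1
  · have hxo : x ∈ o.1 := ho ▸ hx
    have := (mem_map_iff k (x := ⟨x, mem_of_mem o hxo⟩)).2 hxo
    rwa [map_of_mem_omega0 k (x := ⟨x, mem_of_mem o hxo⟩) hx] at this

lemma omega0_mem_carrier (j : V.{u} ↪ₑ[setLang] M) :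
    Ordinal.omega0.{u}.toZFSet ∈ M.carrier := by
  rw [← map_omega0 j (o := toV _) rfl]
  exact (j _).2

/-! ### Sets of functions closed under bounded choices -/

/-- Every set `a` is contained in a set `S` that contains the constant functions on `b` with values
in `a`, and in which every function on `b` can be replaced, at the places where its value is a
member of the value of a given function in `S`. -/
lemma exists_closed_functions (j : V.{u} ↪ₑ[setLang] M) (a b : M) :
    ∃ S : M, a.1 ⊆ S.1 ∧
      (∀ y : M, y.1 ∈ a.1 → ∃ c : M, c.1 ∈ S.1 ∧ ∀ x : M, x.1 ∈ b.1 → y = M.app c x) ∧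
      ∀ f : M, f.1 ∈ S.1 → ∀ h : M, ∃ h' : M, h'.1 ∈ S.1 ∧ ∀ x : M, x.1 ∈ b.1 →
        app h.1 x.1 ∈ app f.1 x.1 → M.app h' x = M.app h x := by
  let P : ∀ M : TransClass.{u}, (ℕ → M) → Prop := fun M _ => ∀ a b : M, ∃ S : M, a.1 ⊆ S.1 ∧
      (∀ y : M, y.1 ∈ a.1 → ∃ c : M, c.1 ∈ S.1 ∧ ∀ x : M, x.1 ∈ b.1 → y = M.app c x) ∧
      ∀ f : M, f.1 ∈ S.1 → ∀ h : M, ∃ h' : M, h'.1 ∈ S.1 ∧ ∀ x : M, x.1 ∈ b.1 →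
        app h.1 x.1 ∈ app f.1 x.1 → ∃ y : M, y = M.app h' x ∧ y = M.app h x
  have h : FO P :=
    .all (.all (.ex (.and (.subset _ _) (.and
      (.all (.imp (.mem _ _) (.ex (.and (.mem _ _) (.all (.imp (.mem _ _) (.eq_app _ _ _)))))))
      (.all (.imp (.mem _ _) (.all (.ex (.and (.mem _ _) (.all (.imp (.mem _ _)
        (.imp (.app_mem_app _ _ _ _)
          (.ex (.and (.eq_app _ _ _) (.eq_app _ _ _)))))))))))))))
  have hV : ∀ v, P V v := by
    refine fun v a b => ?_
    -- the powerset of a limit stage of the cumulative hierarchy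
    obtain ⟨l, hl, ha, hb⟩ : ∃ l : Ordinal.{u}, Order.IsSuccLimit l ∧ a.1 ∈ ZFSet.vonNeumann l ∧
        b.1 ∈ ZFSet.vonNeumann l := by
      refine ⟨max a.1.rank b.1.rank + Ordinal.omega0, Ordinal.isSuccLimit_add _
        Ordinal.isSuccLimit_omega0, ?_, ?_⟩ <;> rw [ZFSet.mem_vonNeumann]
      · exact (le_max_left _ _).trans_lt (lt_add_of_pos_right _ Ordinal.omega0_pos)
      · exact (le_max_right _ _).trans_lt (lt_add_of_pos_right _ Ordinal.omega0_pos)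
    have htr := ZFSet.isTransitive_vonNeumann l
    let T : TransClass.{u} := ⟨{x | x ∈ ZFSet.vonNeumann l},
      fun x hx y hy => htr.subset_of_mem hx hy⟩
    have hpair : ∀ x y, x ∈ ZFSet.vonNeumann l → y ∈ ZFSet.vonNeumann l →
        ZFSet.pair x y ∈ ZFSet.vonNeumann l := by
      have hup : ∀ x y, x ∈ ZFSet.vonNeumann l → y ∈ ZFSet.vonNeumann l →
          ({x, y} : ZFSet.{u}) ∈ ZFSet.vonNeumann l := by
        intro x y hx hy
        rw [ZFSet.mem_vonNeumann] at *
        rw [ZFSet.rank_pair]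
        exact max_lt (hl.succ_lt hx) (hl.succ_lt hy)
      intro x y hx hy
      have := hup _ _ (hup x x hx hx) (hup x y hx hy)
      rwa [ZFSet.pair_eq_singleton] at this
    have hgraph : ∀ F : ZFSet.{u} → ZFSet.{u}, (∀ x ∈ b.1, F x ∈ ZFSet.vonNeumann l) →
        graph b.1 F ∈ (ZFSet.vonNeumann l).powerset := by
      intro F hF
      rw [ZFSet.mem_powerset]
      intro p hp
      obtain ⟨⟨x, hx⟩, rfl⟩ := ZFSet.mem_range.1 hp
      exact hpair _ _ (htr.subset_of_mem hb hx) (hF x hx)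
    refine ⟨toV (ZFSet.vonNeumann l).powerset, fun x hx => ?_, fun y hy => ?_, fun f hf h => ?_⟩
    · exact ZFSet.mem_powerset.2 (htr.subset_of_mem (htr.subset_of_mem ha hx))
    · have := hgraph (fun _ => y.1) fun _ _ => htr.subset_of_mem ha hy
      exact ⟨toV (graph b.1 fun _ => y.1), this,
        fun x hx => Subtype.ext (V_app_graph b.1 (fun _ => y.1) hx).symm⟩
    · classical
      let F : ZFSet.{u} → ZFSet.{u} := fun x =>
        if app h.1 x ∈ app f.1 x then app h.1 x else ∅
      have := hgraph F fun x hx => ?_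
      · exact ⟨toV (graph b.1 F), this, fun x hx hx' =>
          ⟨_, rfl, Subtype.ext ((V_app_graph b.1 F hx).trans (if_pos hx'))⟩⟩
      · simp only [F]
        split_ifs with hx'
        · by_cases hu : ∃! y, ZFSet.pair x y ∈ f.1
          · obtain ⟨y, hy, hy'⟩ := hu
            rw [app_eq hy hy'] at hx'
            exact htr.subset_of_mem
              (right_mem_of_pair_mem (M := T) (ZFSet.mem_powerset.1 hf hy)) hx'
          · rw [app_eq_empty hu] at hx'
            exact absurd hx' (ZFSet.notMem_empty _)
        · exact empty_mem (M := T) hb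
  obtain ⟨S, h1, h2, h3⟩ := h.transfer j hV (fun _ => a) a b
  refine ⟨S, h1, h2, fun f hf h => ?_⟩
  obtain ⟨h', hS, hh⟩ := h3 f hf h
  refine ⟨h', hS, fun x hx hx' => ?_⟩
  obtain ⟨y, hy, hy'⟩ := hh x hx hx'
  rw [← hy, hy']

end InnerModel

/-! ### Countably complete filters -/

section Filters

open Filter

lemma countableInterFilter_of_seq {X : Type*} {l : Filter X}
    (h : ∀ p : ℕ → X → Prop, (∀ n, ∀ᶠ x in l, p n x) → ∀ᶠ x in l, ∀ n, p n x) :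
    CountableInterFilter l where
  countable_sInter_mem S hS hl := by
    rcases S.eq_empty_or_nonempty with rfl | hne
    · simp
    · obtain ⟨f, rfl⟩ := hS.exists_eq_range hne
      have := h (fun n x => x ∈ f n) fun n => hl _ ⟨n, rfl⟩
      filter_upwards [this] with x hx
      simpa using hx

/-- The Ketonen order on countably complete filters is well-founded: there is no sequence of
filters `F n` in which every `F (n + 1)` is the limit along `F n` of filters `G n x` that
concentrate on points below `x` in a well-founded relation. Sets that witness all the
requirements simultaneously are found by countably many successive refinements, and yield a
descending sequence of points. -/
lemma not_descending_filters {X : Type*} {r : X → X → Prop} (hr : WellFounded r)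
    (F : ℕ → Filter X) (hF : ∀ n, CountableInterFilter (F n)) (hF₀ : (F 0).NeBot)
    (G : ℕ → X → Filter X)
    (hG : ∀ n, ∀ᶠ x in F n, (G n x).NeBot ∧ CountableInterFilter (G n x) ∧ ∀ᶠ y in G n x, r y x)
    (hFG : ∀ n (p : X → Prop), (∀ᶠ y in F (n + 1), p y) → ∀ᶠ x in F n, ∀ᶠ y in G n x, p y) :
    False := by
  -- `q k n` is the `k`-th refinement of the requirement on the points of the `n`-th filter
  let q : ℕ → ℕ → X → Prop := fun k => Nat.rec
    (fun n x => (G n x).NeBot ∧ CountableInterFilter (G n x) ∧ ∀ᶠ y in G n x, r y x)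
    (fun _ ih n x => ih n x ∧ ∀ᶠ y in G n x, ih (n + 1) y) k
  have hq : ∀ k n, ∀ᶠ x in F n, q k n x := by
    intro k
    induction k with
    | zero => exact hG
    | succ k ih => exact fun n => (ih n).and (hFG n _ (ih (n + 1)))
  have hstep : ∀ n x, (∀ k, q k n x) → ∃ y, r y x ∧ ∀ k, q k (n + 1) y := by
    intro n x hx
    obtain ⟨hne, hc, hy⟩ := hx 0
    have : ∀ᶠ y in G n x, ∀ k, q k (n + 1) y :=
      eventually_countable_forall.2 fun k => (hx (k + 1)).2
    exact (hy.and this).exists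
  have hno : ∀ x n, ¬ ∀ k, q k n x := by
    intro x
    induction x using hr.induction with
    | h x ih =>
      intro n hx
      obtain ⟨y, hyx, hy⟩ := hstep n x hx
      exact ih y hyx (n + 1) hy
  obtain ⟨x, hx⟩ := (eventually_countable_forall.2 fun k => hq k 0 :
    ∀ᶠ x in F 0, ∀ k, q k 0 x).exists
  exact hno x 0 hx

/-- The filter generated by the members of the set `U`. -/
noncomputable def setFilter (U : ZFSet.{u}) : Filter ZFSet.{u} :=
  ⨅ X ∈ {X | X ∈ U}, 𝓟 {x | x ∈ X}

variable {M : TransClass.{u}} {A U : ZFSet.{u}}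

lemma IsUltrafilterIn.eventually_iff (h : IsUltrafilterIn M A U) {p : ZFSet.{u} → Prop} :
    (∀ᶠ x in setFilter U, p x) ↔ ∃ X ∈ U, ∀ x ∈ X, p x := by
  rw [Filter.Eventually, setFilter, mem_biInf_of_directed]
  · rfl
  · intro X hX Y hY
    refine ⟨_, h.inter_mem X hX Y hY, ?_, ?_⟩ <;> simp only [Order.Preimage,
      ge_iff_le, le_principal_iff, mem_principal] <;> intro x hx
    · exact (ZFSet.mem_inter.1 hx).1
    · exact (ZFSet.mem_inter.1 hx).2
  · exact ⟨A, h.whole_mem⟩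

lemma IsUltrafilterIn.neBot (h : IsUltrafilterIn M A U) : (setFilter U).NeBot := by
  refine ⟨fun hb => ?_⟩
  obtain ⟨X, hX, hX'⟩ := h.eventually_iff.1 (Filter.eventually_false_iff_eq_bot.2 hb)
  rw [(ZFSet.eq_empty X).2 hX'] at hX
  exact h.empty_notMem hX

lemma IsUltrafilterIn.eventually_mem (h : IsUltrafilterIn M A U) {X : ZFSet.{u}} (hX : X ∈ U) :
    ∀ᶠ x in setFilter U, x ∈ X :=
  h.eventually_iff.2 ⟨X, hX, fun _ hx => hx⟩

/-- An ultrafilter decides every subset of its underlying set that belongs to the model. -/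
lemma IsUltrafilterIn.eventually_not (h : IsUltrafilterIn M A U) {X : ZFSet.{u}}
    (hX : X ∈ M.carrier) (hXA : X ⊆ A) {p : ZFSet.{u} → Prop} (hp : ∀ x ∈ A, x ∈ X ↔ p x) :
    (¬ ∀ᶠ x in setFilter U, p x) ↔ ∀ᶠ x in setFilter U, ¬ p x := by
  have := h.neBot
  have hA := h.eventually_mem h.whole_mem
  refine ⟨fun hn => ?_, fun hx hx' => ?_⟩
  · rcases h.ultra X hX hXA with hU | hU
    · refine absurd ?_ hn
      filter_upwards [hA, h.eventually_mem hU] with x hx hx'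
      exact (hp x hx).1 hx'
    · filter_upwards [h.eventually_mem hU] with x hx hx'
      rw [ZFSet.mem_sdiff] at hx
      exact hx.2 ((hp x hx.1).2 hx')
  · obtain ⟨x, hx1, hx2⟩ := (hx.and hx').exists
    exact hx1 hx2

lemma IsUltrafilterIn.eventually_or_not (h : IsUltrafilterIn V A U) (p : ZFSet.{u} → Prop) :
    (∀ᶠ x in setFilter U, p x) ∨ ∀ᶠ x in setFilter U, ¬ p x := by
  rw [← h.eventually_not (X := ZFSet.sep p A) trivial ZFSet.sep_subset
    (fun x hx => by simp [hx])]
  exact em _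

lemma IsUltrafilterIn.countableInterFilter (h : IsUltrafilterIn V A U)
    (hc : IsCountablyCompleteIn V A U) : CountableInterFilter (setFilter U) := by
  refine countableInterFilter_of_seq fun p hp => ?_
  simp only [h.eventually_iff] at hp ⊢
  choose X hXU hX using hp
  have hmem : ∀ {n Y : ZFSet.{u}}, ZFSet.pair n Y ∈
      ZFSet.range (fun n : ℕ => ZFSet.pair (n : Ordinal.{u}).toZFSet (X n)) ↔
        ∃ m : ℕ, (m : Ordinal.{u}).toZFSet = n ∧ X m = Y := by
    intro n Y
    simp [ZFSet.mem_range, ZFSet.pair_inj]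
  refine ⟨_, hc (ZFSet.range fun n : ℕ => ZFSet.pair (n : Ordinal.{u}).toZFSet (X n)) trivial
    ⟨fun z hz => ?_, fun z hz => ?_⟩, fun x hx n => hX n x ?_⟩
  · obtain ⟨n, rfl⟩ := ZFSet.mem_range.1 hz
    exact ZFSet.pair_mem_prod.2 ⟨mem_omega0_iff.2 ⟨n, rfl⟩, hXU n⟩
  · obtain ⟨n, rfl⟩ := mem_omega0_iff.1 hz
    refine ⟨X n, hmem.2 ⟨n, rfl, rfl⟩, fun Y hY => ?_⟩
    obtain ⟨m, hm, rfl⟩ := hmem.1 hY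
    rw [Nat.cast_injective (R := Ordinal.{u}) (Ordinal.toZFSet_injective hm)]
  · exact (ZFSet.mem_sep.1 hx).2 _ _ (hmem.2 ⟨n, rfl, rfl⟩)

/-- The set of the subsets of `A` that belong to the filter `H`. -/
noncomputable def setOfFilter (A : ZFSet.{u}) (H : Filter ZFSet.{u}) : ZFSet.{u} :=
  ZFSet.sep (fun X => ∀ᶠ x in H, x ∈ X) A.powerset

lemma mem_setOfFilter {H : Filter ZFSet.{u}} {X : ZFSet.{u}} :
    X ∈ setOfFilter A H ↔ X ⊆ A ∧ ∀ᶠ x in H, x ∈ X := by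
  rw [setOfFilter, ZFSet.mem_sep, ZFSet.mem_powerset]

lemma isUltrafilterIn_setOfFilter {H : Filter ZFSet.{u}} (hne : H.NeBot)
    (hA : ∀ᶠ x in H, x ∈ A) (hu : ∀ p : ZFSet.{u} → Prop, (∀ᶠ x in H, p x) ∨ ∀ᶠ x in H, ¬ p x) :
    IsUltrafilterIn V A (setOfFilter A H) where
  mem_model := trivial
  subset X hX := (mem_setOfFilter.1 hX).1
  whole_mem := mem_setOfFilter.2 ⟨fun _ h => h, hA⟩
  empty_notMem h := by
    obtain ⟨x, hx⟩ := (mem_setOfFilter.1 h).2.exists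
    exact ZFSet.notMem_empty x hx
  upward X hX Y _ hXY hY := mem_setOfFilter.2 ⟨hY, (mem_setOfFilter.1 hX).2.mono fun _ h => hXY h⟩
  inter_mem X hX Y hY := mem_setOfFilter.2
    ⟨fun x hx => (mem_setOfFilter.1 hX).1 (ZFSet.mem_inter.1 hx).1,
      ((mem_setOfFilter.1 hX).2.and (mem_setOfFilter.1 hY).2).mono fun x hx => ZFSet.mem_inter.2 hx⟩
  ultra X _ hX := (hu (· ∈ X)).imp (fun h => mem_setOfFilter.2 ⟨hX, h⟩) fun h =>
    mem_setOfFilter.2 ⟨fun x hx => (ZFSet.mem_sdiff.1 hx).1,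
      (hA.and h).mono fun x hx => ZFSet.mem_sdiff.2 hx⟩

lemma isCountablyCompleteIn_setOfFilter {H : Filter ZFSet.{u}} (hA : ∀ᶠ x in H, x ∈ A)
    (hc : CountableInterFilter H) : IsCountablyCompleteIn V A (setOfFilter A H) := by
  intro f _ hf
  refine mem_setOfFilter.2 ⟨ZFSet.sep_subset, ?_⟩
  have : ∀ᶠ x in H, ∀ n : ℕ, ∀ X, ZFSet.pair (n : Ordinal.{u}).toZFSet X ∈ f → x ∈ X := by
    refine eventually_countable_forall.2 fun n => ?_
    obtain ⟨X, hX, hX'⟩ := hf.2 _ (mem_omega0_iff.2 ⟨n, rfl⟩)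
    filter_upwards [(mem_setOfFilter.1 (ZFSet.pair_mem_prod.1 (hf.1 hX)).2).2] with x hx Y hY
    exact hX' Y hY ▸ hx
  filter_upwards [hA, this] with x hx hx'
  refine ZFSet.mem_sep.2 ⟨hx, fun n X hp => ?_⟩
  obtain ⟨m, rfl⟩ := mem_omega0_iff.1 (ZFSet.pair_mem_prod.1 (hf.1 hp)).1
  exact hx' m X hp

lemma eventually_setFilter_setOfFilter {H : Filter ZFSet.{u}} (hA : ∀ᶠ x in H, x ∈ A)
    (h : IsUltrafilterIn V A (setOfFilter A H)) {p : ZFSet.{u} → Prop} :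
    (∀ᶠ x in setFilter (setOfFilter A H), p x) ↔ ∀ᶠ x in H, p x := by
  rw [h.eventually_iff]
  constructor
  · rintro ⟨X, hX, hp⟩
    exact (mem_setOfFilter.1 hX).2.mono hp
  · refine fun hp => ⟨ZFSet.sep p A, mem_setOfFilter.2 ⟨ZFSet.sep_subset, ?_⟩, fun x hx =>
      (ZFSet.mem_sep.1 hx).2⟩
    exact (hA.and hp).mono fun x hx => ZFSet.mem_sep.2 hx

end Filters

/-! ### Collapsing well-founded relations -/

lemma exists_collapse_of_wellFounded {E : ZFSet.{u} → ZFSet.{u} → Prop} (hE : WellFounded E)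
    (S : ZFSet.{u}) : ∃ g : ZFSet.{u}, ∀ f ∈ S, ∀ y,
      y ∈ app g f ↔ ∃ h ∈ S, y = app g h ∧ E h f := by
  let G : ZFSet.{u} → ZFSet.{u} := hE.fix fun f ih =>
    ZFSet.range fun h : {h : S // E h.1 f} => ih h.1.1 h.2
  refine ⟨graph S G, fun f hf y => ?_⟩
  rw [app_graph hf]
  have : G f = ZFSet.range fun h : {h : S // E h.1 f} => G h.1.1 := hE.fix_eq _ f
  rw [this, ZFSet.mem_range]
  constructor
  · rintro ⟨⟨⟨h, hS⟩, hE⟩, rfl⟩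
    exact ⟨h, hS, (app_graph hS).symm, hE⟩
  · rintro ⟨h, hS, rfl, hE⟩
    exact ⟨⟨⟨h, hS⟩, hE⟩, (app_graph hS).symm⟩

lemma wellFounded_eventually_mem {l : Filter ZFSet.{u}} (hne : l.NeBot)
    (hc : CountableInterFilter l) :
    WellFounded fun h f : ZFSet.{u} => ∀ᶠ x in l, app h x ∈ app f x := by
  rw [wellFounded_iff_isEmpty_descending_chain]
  refine ⟨fun ⟨s, hs⟩ => ?_⟩
  obtain ⟨x, hx⟩ := (eventually_countable_forall.2 hs).exists
  exact (wellFounded_iff_isEmpty_descending_chain.1 ZFSet.mem_wf).false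
    ⟨fun n => app (s n) x, hx⟩

/-- Inside an elementary target of the universe, the membership relation of the ultrapower by a
countably complete ultrafilter can be collapsed on every set. -/
lemma exists_collapse {M : TransClass.{u}} (j : V.{u} ↪ₑ[setLang] M) {A U : M}
    (hU : IsUltrafilterIn M A.1 U.1) (hc : IsCountablyCompleteIn M A.1 U.1) (S : M) :
    ∃ g : M, ∀ f : M, f.1 ∈ S.1 → ∀ y : M, y.1 ∈ app g.1 f.1 ↔ ∃ h : M, h.1 ∈ S.1 ∧
      y = M.app g h ∧ ∃ B : M, B.1 ∈ U.1 ∧ ∀ x : M, x.1 ∈ B.1 → app h.1 x.1 ∈ app f.1 x.1 := by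
  have h : FO.{u} fun M v => ∀ A U : M, IsUltrafilterIn M A.1 U.1 →
      IsCompleteIn M (v 0).1 A.1 U.1 → ∀ S : M,
      ∃ g : M, ∀ f : M, f.1 ∈ S.1 → ∀ y : M, (∃ z : M, z = M.app g f ∧ y.1 ∈ z.1) ↔
      ∃ h : M, h.1 ∈ S.1 ∧
      y = M.app g h ∧ ∃ B : M, B.1 ∈ U.1 ∧ ∀ x : M, x.1 ∈ B.1 → app h.1 x.1 ∈ app f.1 x.1 :=
    .all (.all (.imp (.isUltrafilterIn _ _) (.imp (.isCompleteIn _ _ _) (.all (.ex (.all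
      (.imp (.mem _ _) (.all (.iff (.ex (.and (.eq_app _ _ _) (.mem _ _)))
      (.ex (.and (.mem _ _) (.and (.eq_app _ _ _) (.ex (.and (.mem _ _)
        (.all (.imp (.mem _ _) (.app_mem_app _ _ _ _)))))))))))))))))
  have hM := (h.map_iff j fun _ => toV Ordinal.omega0.toZFSet).2 fun A U hU hc S => by
    obtain ⟨g, hg⟩ := exists_collapse_of_wellFounded
      (wellFounded_eventually_mem hU.neBot (hU.countableInterFilter hc)) S.1
    refine ⟨toV g, fun f hf y => ?_⟩
    rw [exists_eq_left]
    refine (hg f.1 hf y.1).trans ?_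
    simp only [hU.eventually_iff]
    rw [exists_mem_iff S]
    refine exists_congr fun h => and_congr_right fun _ => and_congr ?_ ?_
    · exact (Subtype.ext_iff (a1 := y) (a2 := V.app (toV g) h)).symm
    · rw [exists_mem_iff U]
      exact exists_congr fun B => and_congr_right fun _ => forall_mem_iff B
  beta_reduce at hM
  rw [map_omega0 j (o := toV Ordinal.omega0.toZFSet) rfl] at hM
  simp only [exists_eq_left] at hM
  exact hM A U hU hc S

/-! ### Tail ultrafilters that are minimal in the Ketonen order -/

/-- In `M`, `U` is an ultrafilter on `A` that is complete for sequences with index set `o` and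
contains `A \ β` for every `β ∈ A`. -/
def IsTailUltrafilter (M : TransClass.{u}) (o A U : ZFSet.{u}) : Prop :=
  IsUltrafilterIn M A U ∧ IsCompleteIn M o A U ∧ ∀ β ∈ A, A \ β ∈ U

/-- In `M`, the ultrafilter `U` is not minimal: for `U`-almost all `ξ`, `w ξ` is a complete
ultrafilter on the subset `g ξ` of `ξ`, and every `β ∈ A` has `g ξ \ β ∈ w ξ` for `U`-almost
all `ξ`. -/
def IsReducedBy (M : TransClass.{u}) (o A U g w : M) : Prop :=
  (∃ B : M, B.1 ∈ U.1 ∧ ∀ x : M, x.1 ∈ B.1 → (M.app g x).1 ⊆ x.1 ∧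
    IsUltrafilterIn M (M.app g x).1 (M.app w x).1 ∧
      IsCompleteIn M o.1 (M.app g x).1 (M.app w x).1) ∧
  ∀ β : M, β.1 ∈ A.1 → ∃ B : M, B.1 ∈ U.1 ∧ ∀ x : M, x.1 ∈ B.1 →
    (M.app g x).1 \ β.1 ∈ (M.app w x).1

lemma FO.isTailUltrafilter (o i j : ℕ) :
    FO.{u} fun M v => IsTailUltrafilter M (v o).1 (v i).1 (v j).1 := by
  have h : FO.{u} fun M v => IsUltrafilterIn M (v i).1 (v j).1 ∧
      IsCompleteIn M (v o).1 (v i).1 (v j).1 ∧ ∀ β : M, β.1 ∈ (v i).1 → (v i).1 \ β.1 ∈ (v j).1 :=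
    .and (.isUltrafilterIn _ _) (.and (.isCompleteIn _ _ _)
      (.all (.imp (.mem _ _) (.sdiff_mem _ _ _))))
  exact h.congr fun M v => and_congr_right fun _ => and_congr_right fun _ => forall_mem_iff (v i)

lemma FO.reducedBy_fst (i o k l : ℕ) :
    FO.{u} fun M v => (M.app (v k) (v i)).1 ⊆ (v i).1 ∧
      IsUltrafilterIn M (M.app (v k) (v i)).1 (M.app (v l) (v i)).1 ∧
      IsCompleteIn M (v o).1 (M.app (v k) (v i)).1 (M.app (v l) (v i)).1 := by
  refine .comp_app (R := fun M v a => a.1 ⊆ (v i).1 ∧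
    IsUltrafilterIn M a.1 (M.app (v l) (v i)).1 ∧
    IsCompleteIn M (v o).1 a.1 (M.app (v l) (v i)).1) ?_ k i
  refine .comp_app (R := fun M v c => (v 0).1 ⊆ (v (i + 1)).1 ∧ IsUltrafilterIn M (v 0).1 c.1 ∧
    IsCompleteIn M (v (o + 1)).1 (v 0).1 c.1) ?_ (l + 1) (i + 1)
  exact .and (.subset _ _) (.and (.isUltrafilterIn _ _) (.isCompleteIn _ _ _))

lemma FO.reducedBy_snd (i b k l : ℕ) :
    FO.{u} fun M v => (M.app (v k) (v i)).1 \ (v b).1 ∈ (M.app (v l) (v i)).1 := by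
  refine .comp_app (R := fun M v a => a.1 \ (v b).1 ∈ (M.app (v l) (v i)).1) ?_ k i
  refine .comp_app (R := fun M v c => (v 0).1 \ (v (b + 1)).1 ∈ c.1) ?_ (l + 1) (i + 1)
  exact .sdiff_mem _ _ _

lemma FO.isReducedBy (o i j k l : ℕ) :
    FO.{u} fun M v => IsReducedBy M (v o) (v i) (v j) (v k) (v l) :=
  .and (.ex (.and (.mem _ _) (.all (.imp (.mem _ _) (.reducedBy_fst _ _ _ _)))))
    (.all (.imp (.mem _ _) (.ex (.and (.mem _ _) (.all (.imp (.mem _ _)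
      (.reducedBy_snd _ _ _ _)))))))

/-- In the universe, the limit of the ultrafilters `w ξ` is again a tail ultrafilter on `A`, and it
lies below `U` in the Ketonen order; so some tail ultrafilter is not reduced. -/
lemma exists_not_isReducedBy_V {A : V.{u}} (hA : A.1.IsTransitive) (hT : IsTailUniformIn V A.1) :
    ∃ U : V.{u}, IsTailUltrafilter V Ordinal.omega0.toZFSet A.1 U.1 ∧
      ¬ ∃ g w, IsReducedBy V (toV Ordinal.omega0.toZFSet) A U g w := by
  by_contra! hcon
  choose! g w hgw using hcon
  -- the ultrafilter that `w` reduces `U` to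
  let H : V.{u} → Filter ZFSet.{u} := fun U =>
    (setFilter U.1).bind fun x => setFilter (app (w U).1 x)
  let D : V.{u} → V.{u} := fun U => toV (setOfFilter A.1 (H U))
  have hgood : ∀ U : V.{u}, IsTailUltrafilter V Ordinal.omega0.toZFSet A.1 U.1 →
      ∀ᶠ x in setFilter U.1, app (g U).1 x ⊆ x ∧ x ∈ A.1 ∧
        IsUltrafilterIn V (app (g U).1 x) (app (w U).1 x) ∧
        IsCountablyCompleteIn V (app (g U).1 x) (app (w U).1 x) := by
    intro U hU
    obtain ⟨B, hB, hB'⟩ := (hgw U hU).1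
    filter_upwards [hU.1.eventually_mem hB, hU.1.eventually_mem hU.1.whole_mem] with x hx hxA
    obtain ⟨h1, h2⟩ := hB' (toV x) hx
    exact ⟨h1, hxA, h2⟩
  have hHA : ∀ U : V.{u}, IsTailUltrafilter V Ordinal.omega0.toZFSet A.1 U.1 →
      ∀ᶠ x in H U, x ∈ A.1 := by
    intro U hU
    refine Filter.eventually_bind.2 ((hgood U hU).mono fun x hx => ?_)
    filter_upwards [hx.2.2.1.eventually_mem hx.2.2.1.whole_mem] with y hy
    exact hA.subset_of_mem hx.2.1 (hx.1 hy)
  have hD : ∀ U : V.{u}, IsTailUltrafilter V Ordinal.omega0.toZFSet A.1 U.1 →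
      IsTailUltrafilter V Ordinal.omega0.toZFSet A.1 (D U).1 := by
    intro U hU
    have hne := hU.1.neBot
    have hc := hU.1.countableInterFilter hU.2.1
    refine ⟨isUltrafilterIn_setOfFilter ⟨fun hb => ?_⟩ (hHA U hU) fun p => ?_,
      isCountablyCompleteIn_setOfFilter (hHA U hU) (countableInterFilter_of_seq fun p hp => ?_),
      fun β hβ => mem_setOfFilter.2 ⟨fun x hx => (ZFSet.mem_sdiff.1 hx).1, ?_⟩⟩
    · have := Filter.eventually_bind.1 (Filter.eventually_false_iff_eq_bot.2 hb)
      obtain ⟨x, hx, hx'⟩ := (this.and (hgood U hU)).exists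
      have := hx'.2.2.1.neBot
      exact hx.exists.elim fun _ h => h
    · refine (hU.1.eventually_or_not
        fun x => ∀ᶠ y in setFilter (app (w U).1 x), p y).imp id fun h => ?_
      refine Filter.eventually_bind.2 ((h.and (hgood U hU)).mono fun x hx => ?_)
      exact (hx.2.2.2.1.eventually_or_not p).resolve_left hx.1
    · have : ∀ᶠ x in setFilter U.1, ∀ n, ∀ᶠ y in setFilter (app (w U).1 x), p n y :=
        eventually_countable_forall.2 hp
      refine Filter.eventually_bind.2 ((this.and (hgood U hU)).mono fun x hx => ?_)
      have := hx.2.2.2.1.countableInterFilter hx.2.2.2.2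
      exact eventually_countable_forall.2 hx.1
    · obtain ⟨B, hB, hB'⟩ := (hgw U hU).2 (toV β) hβ
      refine Filter.eventually_bind.2 (((hU.1.eventually_mem hB).and (hgood U hU)).mono
        fun x hx => ?_)
      filter_upwards [hx.2.2.2.1.eventually_mem (hB' (toV x) hx.1)] with y hy
      obtain ⟨h1, h2⟩ := ZFSet.mem_sdiff.1 hy
      exact ZFSet.mem_sdiff.2 ⟨hA.subset_of_mem hx.2.2.1 (hx.2.1 h1), h2⟩
  obtain ⟨U₀, h1, h2, h3⟩ := hT
  let s : ℕ → V.{u} := fun n => D^[n] (toV U₀)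
  have hs : ∀ n, IsTailUltrafilter V Ordinal.omega0.toZFSet A.1 (s n).1 := by
    intro n
    induction n with
    | zero => exact ⟨h1, h2, h3⟩
    | succ n ih =>
      simp only [s, Function.iterate_succ_apply']
      exact hD _ ih
  refine not_descending_filters ZFSet.mem_wf (fun n => setFilter (s n).1)
    (fun n => (hs n).1.countableInterFilter (hs n).2.1) (hs 0).1.neBot
    (fun n x => setFilter (app (w (s n)).1 x)) (fun n => ?_) fun n p hp => ?_
  · filter_upwards [hgood _ (hs n)] with x hx
    refine ⟨hx.2.2.1.neBot, hx.2.2.1.countableInterFilter hx.2.2.2, ?_⟩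
    filter_upwards [hx.2.2.1.eventually_mem hx.2.2.1.whole_mem] with y hy
    exact hx.1 hy
  · have hn := (hs (n + 1)).1
    simp only [s, Function.iterate_succ_apply'] at hp hn
    exact Filter.eventually_bind.1 ((eventually_setFilter_setOfFilter (hHA _ (hs n)) hn).1 hp)

/-- Inside an elementary target of the universe, a tail uniform ordinal carries a tail ultrafilter
that is minimal in the Ketonen order. -/
lemma exists_not_isReducedBy {M : TransClass.{u}} (j : V.{u} ↪ₑ[setLang] M) {A o : M}
    (ho : o.1 = Ordinal.omega0.toZFSet) (hA : A.1.IsTransitive) (hT : IsTailUniformIn M A.1) :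
    ∃ U : M, IsTailUltrafilter M o.1 A.1 U.1 ∧ ¬ ∃ g w, IsReducedBy M o A U g w := by
  have h : FO.{u} fun M v => ∀ A : M, (∀ x : M, x.1 ∈ A.1 → x.1 ⊆ A.1) →
      (∃ U : M, IsTailUltrafilter M (v 0).1 A.1 U.1) →
      ∃ U : M, IsTailUltrafilter M (v 0).1 A.1 U.1 ∧ ¬ ∃ g w : M, IsReducedBy M (v 0) A U g w :=
    .all (.imp (.all (.imp (.mem _ _) (.subset _ _))) (.imp (.ex (.isTailUltrafilter _ _ _))
      (.ex (.and (.isTailUltrafilter _ _ _) (.not (.ex (.ex (.isReducedBy _ _ _ _ _))))))))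
  have hM := (h.map_iff j fun _ => toV Ordinal.omega0.toZFSet).2 fun A hA ⟨U, hU⟩ =>
    exists_not_isReducedBy_V (fun x hx => hA (toV x) hx) ⟨U.1, hU⟩
  have hjo : j (toV Ordinal.omega0.toZFSet) = o :=
    Subtype.ext ((map_omega0 j (o := toV Ordinal.omega0.toZFSet) rfl).trans ho.symm)
  rw [hjo] at hM
  obtain ⟨U, hU⟩ := hT
  refine hM A (fun x hx => hA.subset_of_mem hx) ⟨⟨U, hU.1.mem_model⟩, ?_⟩
  rw [ho]
  exact hU

/-! ### Derived ultrafilters and internal embeddings -/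

section Derived

variable {M N : TransClass.{u}}

/-- `D` is the ultrafilter on `b` that is derived from `k` using the point `x` of `k b`. -/
def IsDerived (k : M ↪ₑ[setLang] N) (b : M) (x : N) (D : M) : Prop :=
  ∀ X : M, X.1 ∈ D.1 ↔ X.1 ⊆ b.1 ∧ x.1 ∈ (k X).1

lemma exists_sdiff (j : V.{u} ↪ₑ[setLang] M) (x y : M) : ∃ z : M, z.1 = x.1 \ y.1 := by
  obtain ⟨z, hz⟩ := exists_sep j (.not (.mem 0 1)) (fun _ => y) x
  refine ⟨z, ZFSet.ext fun t => ?_⟩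
  rw [ZFSet.mem_sdiff]
  exact ⟨fun h => (hz ⟨t, mem_of_mem z h⟩).1 h, fun h => (hz ⟨t, mem_of_mem x h.1⟩).2 h⟩

lemma map_sdiff (k : M ↪ₑ[setLang] N) {x y z : M} (h : z.1 = x.1 \ y.1) :
    (k z).1 = (k x).1 \ (k y).1 := by
  have hFO : FO.{u} fun M v => ∀ t : M, t.1 ∈ (v 0).1 ↔ t.1 ∈ (v 1).1 ∧ ¬ t.1 ∈ (v 2).1 :=
    .all (.iff (.mem _ _) (.and (.mem _ _) (.not (.mem _ _))))
  have hN := (hFO.map_iff k (scons z (scons x fun _ => y))).2 fun t => by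
    simp [scons, h]
  refine ZFSet.ext fun t => ?_
  rw [ZFSet.mem_sdiff]
  exact ⟨fun h => (hN ⟨t, mem_of_mem _ h⟩).1 h, fun h => (hN ⟨t, mem_of_mem _ h.1⟩).2 h⟩

/-- Łoś's theorem for the derived ultrafilter. -/
lemma IsDerived.realize_iff (j : V.{u} ↪ₑ[setLang] M) {k : M ↪ₑ[setLang] N} {b D : M} {x : N}
    (hx : x.1 ∈ (k b).1) (hD : IsDerived k b x D)
    {P : ∀ M : TransClass.{u}, (ℕ → M) → Prop} (hP : FO P) (v : ℕ → M) :
    P N (scons x fun n => k (v n)) ↔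
      ∃ B : M, B.1 ∈ D.1 ∧ ∀ t : M, t.1 ∈ B.1 → P M (scons t v) := by
  constructor
  · intro h
    obtain ⟨B, hB⟩ := exists_sep j hP v b
    have hFO : FO.{u} fun M v => ∀ t : M, t.1 ∈ (v 0).1 ↔ t.1 ∈ (v 1).1 ∧
        P M (scons t fun n => v (n + 2)) :=
      .all (.iff (.mem _ _) (.and (.mem _ _) (hP.subst₁ 0 3)))
    have hN := (hFO.map_iff k (scons B (scons b v))).2 hB
    refine ⟨B, (hD B).2 ⟨fun t ht => ((hB ⟨t, mem_of_mem B ht⟩).1 ht).1, (hN x).2 ⟨hx, h⟩⟩,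
      fun t ht => ((hB t).1 ht).2⟩
  · rintro ⟨B, hB, h⟩
    have hFO : FO.{u} fun M v => ∀ t : M, t.1 ∈ (v 0).1 → P M (scons t fun n => v (n + 1)) :=
      .all (.imp (.mem _ _) (hP.subst₁ 0 2))
    exact (hFO.map_iff k (scons B v)).2 h x ((hD B).1 hB).2

lemma IsDerived.isUltrafilterIn (j : V.{u} ↪ₑ[setLang] M) {k : M ↪ₑ[setLang] N} {b D : M} {x : N}
    (hx : x.1 ∈ (k b).1) (hD : IsDerived k b x D) : IsUltrafilterIn M b.1 D.1 where
  mem_model := D.2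
  subset X hX := ((hD ⟨X, mem_of_mem D hX⟩).1 hX).1
  whole_mem := (hD b).2 ⟨fun _ h => h, hx⟩
  empty_notMem h := by
    have h1 := ((hD ⟨∅, mem_of_mem D h⟩).1 h).2
    rw [((FO.eq_empty 0).map_iff k fun _ => ⟨∅, mem_of_mem D h⟩).2 rfl] at h1
    exact ZFSet.notMem_empty _ h1
  upward X hX Y hY hXY hYb := (hD ⟨Y, hY⟩).2 ⟨hYb,
    (subset_map_iff k (x := ⟨X, mem_of_mem D hX⟩)).2 hXY ((hD ⟨X, mem_of_mem D hX⟩).1 hX).2⟩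
  inter_mem X hX Y hY := by
    obtain ⟨hXb, hXx⟩ := (hD ⟨X, mem_of_mem D hX⟩).1 hX
    obtain ⟨hYb, hYx⟩ := (hD ⟨Y, mem_of_mem D hY⟩).1 hY
    -- `X ∩ Y = X \ (X \ Y)`
    obtain ⟨Z, hZ⟩ := exists_sdiff j ⟨X, mem_of_mem D hX⟩ ⟨Y, mem_of_mem D hY⟩
    obtain ⟨W, hW⟩ := exists_sdiff j ⟨X, mem_of_mem D hX⟩ Z
    have : W.1 = X ∩ Y := by
      rw [hW, hZ]
      ext t
      simp only [ZFSet.mem_sdiff, ZFSet.mem_inter]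
      tauto
    rw [← this]
    refine (hD W).2 ⟨fun t ht => hXb (ZFSet.mem_inter.1 (this ▸ ht)).1, ?_⟩
    rw [map_sdiff k hW, map_sdiff k hZ, ZFSet.mem_sdiff, ZFSet.mem_sdiff]
    exact ⟨hXx, fun h => h.2 hYx⟩
  ultra X hX hXb := by
    obtain ⟨Z, hZ⟩ := exists_sdiff j b ⟨X, hX⟩
    by_cases h : x.1 ∈ (k ⟨X, hX⟩).1
    · exact .inl ((hD ⟨X, hX⟩).2 ⟨hXb, h⟩)
    · refine .inr (hZ ▸ (hD Z).2 ⟨fun t ht => ?_, ?_⟩)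
      · exact (ZFSet.mem_sdiff.1 (hZ ▸ ht)).1
      · rw [map_sdiff k hZ]
        exact ZFSet.mem_sdiff.2 ⟨hx, h⟩

lemma IsDerived.isCountablyCompleteIn (j : V.{u} ↪ₑ[setLang] M) {k : M ↪ₑ[setLang] N} {b D : M}
    {x : N} (hx : x.1 ∈ (k b).1) (hD : IsDerived k b x D) : IsCountablyCompleteIn M b.1 D.1 := by
  intro f hf hfun
  obtain ⟨f, rfl⟩ : ∃ f' : M, f'.1 = f := ⟨⟨f, hf⟩, rfl⟩
  have hFO : FO.{u} fun M v => ∀ n X : M, ZFSet.pair n.1 X.1 ∈ (v 1).1 → (v 0).1 ∈ X.1 :=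
    .all (.all (.imp (.pair_mem _ _ _) (.mem _ _)))
  obtain ⟨B, hB⟩ := exists_sep j hFO (fun _ => f) b
  have hBeq : ZFSet.sep (fun a => ∀ n X : ZFSet.{u}, ZFSet.pair n X ∈ f.1 → a ∈ X) b.1 = B.1 := by
    refine ZFSet.ext fun t => ?_
    rw [ZFSet.mem_sep]
    constructor
    · intro ht
      exact (hB ⟨t, mem_of_mem b ht.1⟩).2 ⟨ht.1, fun n X => ht.2 n.1 X.1⟩
    · intro ht
      obtain ⟨h1, h2⟩ := (hB ⟨t, mem_of_mem B ht⟩).1 ht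
      exact ⟨h1, fun n X hp => h2 ⟨n, left_mem_of_pair_mem (mem_of_mem f hp)⟩
        ⟨X, right_mem_of_pair_mem (mem_of_mem f hp)⟩ hp⟩
  rw [hBeq]
  refine (hD B).2 ⟨fun t ht => ((hB ⟨t, mem_of_mem B ht⟩).1 ht).1, ?_⟩
  have hFO' : FO.{u} fun M v => ∀ t : M, t.1 ∈ (v 0).1 ↔ t.1 ∈ (v 1).1 ∧
      ∀ n X : M, ZFSet.pair n.1 X.1 ∈ (v 2).1 → t.1 ∈ X.1 :=
    .all (.iff (.mem _ _) (.and (.mem _ _) (.all (.all (.imp (.pair_mem _ _ _) (.mem _ _))))))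
  refine ((hFO'.map_iff k (scons B (scons b fun _ => f))).2 hB x).2 ⟨hx, fun n X hp => ?_⟩
  -- `k f` is a function on `ω`, and its values are the images of the values of `f`
  let o : M := ⟨_, omega0_mem_carrier j⟩
  have hdom : FO.{u} fun M v => ∀ n X : M, ZFSet.pair n.1 X.1 ∈ (v 0).1 → n.1 ∈ (v 1).1 :=
    .all (.all (.imp (.pair_mem _ _ _) (.mem _ _)))
  have hn : n.1 ∈ (k o).1 := (hdom.map_iff k (scons f fun _ => o)).2
    (fun n X hp => (ZFSet.pair_mem_prod.1 (hfun.1 hp)).1) n X hp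
  rw [map_omega0 k (o := o) rfl] at hn
  have hnk : n = k ⟨n.1, mem_of_mem o hn⟩ :=
    Subtype.ext (map_of_mem_omega0 k (x := ⟨n.1, mem_of_mem o hn⟩) hn).symm
  obtain ⟨Y, hY, hY'⟩ := hfun.2 n.1 hn
  have hYD : Y ∈ D.1 := (ZFSet.pair_mem_prod.1 (hfun.1 hY)).2
  have huniq : FO.{u} fun M v => ∀ X : M, ZFSet.pair (v 0).1 X.1 ∈ (v 1).1 → X = v 2 :=
    .all (.imp (.pair_mem _ _ _) (.eq _ _))
  have hX : X = k ⟨Y, mem_of_mem D hYD⟩ := by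
    refine (huniq.map_iff k (scons ⟨n.1, mem_of_mem o hn⟩ (scons f fun _ =>
      ⟨Y, mem_of_mem D hYD⟩))).2 (fun X hX => Subtype.ext (hY' X.1 hX)) X ?_
    simp only [scons, ← hnk]
    exact hp
  rw [hX]
  exact ((hD _).1 hYD).2

/-- The target of an internal embedding of `M` is contained in `M`, and all ultrafilters derived
from an internal embedding of `M` belong to `M`. -/
lemma IsInternalUltrapower.exists_isDerived (j : V.{u} ↪ₑ[setLang] M) {i : M ↪ₑ[setLang] N}
    (hi : IsInternalUltrapower i) (b : M) (x : N) : ∃ D, IsDerived i b x D := by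
  have hx : x.1 ∈ M.carrier := by
    obtain ⟨a, ha⟩ := exists_mem_map (i.comp j) x
    obtain ⟨P, hP⟩ := exists_powerset j (j a)
    obtain ⟨g, hg⟩ := hi.2 P
    have : ZFSet.pair (j a).1 (i (j a)).1 ∈ g.1 := (hg _).2 ⟨j a, (hP _).2 fun _ h => h, rfl⟩
    exact M.transitive _ (right_mem_of_pair_mem (mem_of_mem g this)) _ ha
  obtain ⟨P, hP⟩ := exists_powerset j b
  obtain ⟨g, hg⟩ := hi.2 P
  have hFO : FO.{u} fun M v => ∃ y : M, ZFSet.pair (v 0).1 y.1 ∈ (v 1).1 ∧ (v 2).1 ∈ y.1 :=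
    .ex (.and (.pair_mem _ _ _) (.mem _ _))
  obtain ⟨D, hD⟩ := exists_sep j hFO (scons g fun _ => ⟨x.1, hx⟩) P
  refine ⟨D, fun X => (hD X).trans ?_⟩
  rw [hP]
  refine and_congr_right fun hXb => ⟨?_, fun h => ?_⟩
  · rintro ⟨y, hy, hxy⟩
    obtain ⟨a, _, hp⟩ := (hg _).1 hy
    obtain ⟨h1, h2⟩ := ZFSet.pair_inj.1 hp
    rw [show X = a from Subtype.ext h1, ← h2]
    exact hxy
  · have : ZFSet.pair X.1 (i X).1 ∈ g.1 := (hg _).2 ⟨X, (hP X).2 hXb, rfl⟩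
    exact ⟨⟨_, right_mem_of_pair_mem (mem_of_mem g this)⟩, this, h⟩

/-- The set of the pairs of a point `y` of `a` with the value of `g` at a function in `S` that is
constant on `b` with value `y`. -/
lemma exists_restriction (j : V.{u} ↪ₑ[setLang] M) (a b S g : M) :
    ∃ r : M, ∀ p : M, p.1 ∈ r.1 ↔ ∃ y : M, y.1 ∈ a.1 ∧ ∃ c : M, c.1 ∈ S.1 ∧
      (∀ x : M, x.1 ∈ b.1 → y = M.app c x) ∧ p.1 = ZFSet.pair y.1 (M.app g c).1 := by
  have h : FO.{u} fun M v => ∀ a b S g : M, ∃ r : M, ∀ p : M, p.1 ∈ r.1 ↔ ∃ y : M, y.1 ∈ a.1 ∧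
      ∃ c : M, c.1 ∈ S.1 ∧ (∀ x : M, x.1 ∈ b.1 → y = M.app c x) ∧
      ∃ z : M, z = M.app g c ∧ p.1 = ZFSet.pair y.1 z.1 :=
    .all (.all (.all (.all (.ex (.all (.iff (.mem _ _) (.ex (.and (.mem _ _) (.ex (.and (.mem _ _)
      (.and (.all (.imp (.mem _ _) (.eq_app _ _ _)))
        (.ex (.and (.eq_app _ _ _) (.eq_pair _ _ _))))))))))))))
  have hM := h.transfer j (fun v a b S g => by
    refine ⟨toV (ZFSet.sep (fun p => ∃ y : V.{u}, y.1 ∈ a.1 ∧ ∃ c : V.{u}, c.1 ∈ S.1 ∧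
      (∀ x : V.{u}, x.1 ∈ b.1 → y = V.app c x) ∧
      ∃ z : V.{u}, z = V.app g c ∧ p = ZFSet.pair y.1 z.1)
      (ZFSet.prod a.1 (ZFSet.range fun c : S.1 => app g.1 c.1))), fun p => ?_⟩
    rw [toV_val, ZFSet.mem_sep, and_iff_right_iff_imp]
    rintro ⟨y, hy, c, hc, _, z, rfl, hp⟩
    rw [hp, ZFSet.pair_mem_prod]
    exact ⟨hy, ZFSet.mem_range.2 ⟨⟨c.1, hc⟩, rfl⟩⟩) (fun _ => a) a b S g
  simpa only [exists_eq_left] using hM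

/-- An ultrapower embedding of `M` whose derived ultrafilter at a generator belongs to `M` is
internal to `M`: the collapse of the ultrapower of a set of functions can be computed in `M`, and
it sends the constant function with value `y` to `k y`. -/
lemma isInternalUltrapower_of_isDerived (j : V.{u} ↪ₑ[setLang] M) (k : M ↪ₑ[setLang] N)
    {b D : M} {x : N} (hgen : ∀ y, ∃ f : M, y = N.app (k f) x) (hx : x.1 ∈ (k b).1)
    (hD : IsDerived k b x D) : IsInternalUltrapower k := by
  refine ⟨(isUltrapower_iff j k).2 ⟨x, hgen⟩, fun a => ?_⟩
  obtain ⟨S, -, hconst, hS⟩ := exists_closed_functions j a b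
  obtain ⟨g, hg⟩ := exists_collapse j (hD.isUltrafilterIn j hx) (hD.isCountablyCompleteIn j hx) S
  have hmem : ∀ h f : M, (∃ B : M, B.1 ∈ D.1 ∧ ∀ t : M, t.1 ∈ B.1 → app h.1 t.1 ∈ app f.1 t.1) ↔
      (N.app (k h) x).1 ∈ (N.app (k f) x).1 := fun h f =>
    (hD.realize_iff j hx (FO.app_mem_app 1 0 2 0) (scons h fun _ => f)).symm
  have hcollapse : ∀ z : ZFSet.{u}, ∀ f : M, f.1 ∈ S.1 → (N.app (k f) x).1 = z →
      app g.1 f.1 = z := by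
    intro z
    induction z using ZFSet.inductionOn with
    | h z ih =>
      rintro f hf rfl
      refine ZFSet.ext fun y => ⟨fun hy => ?_, fun hy => ?_⟩
      · obtain ⟨h, hh, hyh, hE⟩ := (hg f hf ⟨y, mem_of_mem (M.app g f) hy⟩).1 hy
        rw [hmem] at hE
        rw [← ih _ hE h hh rfl] at hE
        rw [show y = app g.1 h.1 from congrArg Subtype.val hyh]
        exact hE
      · obtain ⟨h, hh⟩ := hgen ⟨y, mem_of_mem _ hy⟩
        obtain ⟨h', hh', heq⟩ := hS f hf h
        have hhy : (N.app (k h) x).1 = y := (congrArg Subtype.val hh).symm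
        obtain ⟨B, hB, hB'⟩ := (hmem h f).2 (hhy.symm ▸ hy)
        have hBb := (hD.isUltrafilterIn j hx).subset _ hB
        have hx' : N.app (k h') x = N.app (k h) x := by
          have hFO : FO.{u} fun M v => ∃ z : M, z = M.app (v 1) (v 0) ∧ z = M.app (v 2) (v 0) :=
            .ex (.and (.eq_app _ _ _) (.eq_app _ _ _))
          obtain ⟨z, hz, hz'⟩ := (hD.realize_iff j hx hFO (scons h' fun _ => h)).2
            ⟨B, hB, fun t ht => ⟨_, rfl, heq t (hBb ht) (hB' t ht)⟩⟩
          exact hz.symm.trans hz'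
        have hy' : (N.app (k h') x).1 = y := by rw [hx', hhy]
        have hgy : app g.1 h'.1 = y := ih y hy h' hh' hy'
        rw [← hgy]
        exact (hg f hf (M.app g h')).2 ⟨h', hh', rfl, (hmem h' f).2 (hy'.symm ▸ hy)⟩
  have hk : ∀ y c : M, c.1 ∈ S.1 → (∀ t : M, t.1 ∈ b.1 → y = M.app c t) →
      (M.app g c).1 = (k y).1 := by
    intro y c hc hyc
    refine hcollapse _ c hc ?_
    have hFO : FO.{u} fun M v => ∀ t : M, t.1 ∈ (v 0).1 → v 1 = M.app (v 2) t :=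
      .all (.imp (.mem _ _) (.eq_app _ _ _))
    exact congrArg Subtype.val
      ((hFO.map_iff k (scons b (scons y fun _ => c))).2 hyc x hx).symm
  obtain ⟨r, hr⟩ := exists_restriction j a b S g
  refine ⟨r, fun p => ⟨fun hp => ?_, ?_⟩⟩
  · obtain ⟨y, hy, c, hc, hyc, hp'⟩ := (hr ⟨p, mem_of_mem r hp⟩).1 hp
    exact ⟨y, hy, by rw [← hk y c hc hyc]; exact hp'⟩
  · rintro ⟨y, hy, rfl⟩
    obtain ⟨c, hc, hyc⟩ := hconst y hy
    rw [← hk y c hc hyc]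
    exact (hr ⟨_, pair_mem_carrier j y (M.app g c)⟩).2 ⟨y, hy, c, hc, hyc, rfl⟩

end Derived

/-! ### The supremum of the image of a regular cardinal -/

section SupImage

variable {M N : TransClass.{u}} {δ : Cardinal.{u}}

lemma mem_supImage {j : V.{u} ↪ₑ[setLang] M} {x : ZFSet.{u}} :
    x ∈ supImage j δ ↔ ∃ ξ < δ.ord, x ∈ (j (toV ξ.toZFSet)).1 := by
  simp [supImage, ZFSet.mem_iUnion]

lemma FO.isOrdinal (i : ℕ) : FO.{u} fun _ v => (v i).1.IsOrdinal := by
  have h : FO.{u} fun M v => (∀ x : M, x.1 ∈ (v i).1 → x.1 ⊆ (v i).1) ∧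
      ∀ y : M, y.1 ∈ (v i).1 → ∀ x : M, x.1 ∈ y.1 → x.1 ⊆ y.1 :=
    .and (.all (.imp (.mem _ _) (.subset _ _)))
      (.all (.imp (.mem _ _) (.all (.imp (.mem _ _) (.subset _ _)))))
  refine h.congr fun M v => ?_
  rw [ZFSet.isOrdinal_iff_forall_mem_isTransitive]
  refine and_congr (forall_mem_iff (v i)) ((forall_mem_iff (v i)).trans ?_)
  exact forall_congr' fun y => imp_congr_right fun _ => forall_mem_iff y

lemma isOrdinal_map (k : M ↪ₑ[setLang] N) {x : M} (hx : x.1.IsOrdinal) : (k x).1.IsOrdinal :=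
  ((FO.isOrdinal 0).map_iff k fun _ => x).2 hx

lemma isOrdinal_supImage (j : V.{u} ↪ₑ[setLang] M) : (supImage j δ).IsOrdinal := by
  have hj : ∀ ξ : Ordinal.{u}, (j (toV ξ.toZFSet)).1.IsOrdinal := fun ξ =>
    isOrdinal_map j (x := toV ξ.toZFSet) (ZFSet.isOrdinal_toZFSet ξ)
  rw [ZFSet.isOrdinal_iff_forall_mem_isOrdinal]
  constructor
  · intro x hx y hy
    obtain ⟨ξ, hξ, hx⟩ := mem_supImage.1 hx
    exact mem_supImage.2 ⟨ξ, hξ, (hj ξ).mem_trans hy hx⟩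
  · intro x hx
    obtain ⟨ξ, hξ, hx⟩ := mem_supImage.1 hx
    exact (hj ξ).mem hx

lemma supImage_mem_carrier (j : V.{u} ↪ₑ[setLang] M) (δ : Cardinal.{u}) :
    supImage j δ ∈ M.carrier := by
  have hδ : (j (toV δ.ord.toZFSet)).1.IsOrdinal :=
    isOrdinal_map j (x := toV δ.ord.toZFSet) (ZFSet.isOrdinal_toZFSet _)
  have hsub : supImage j δ ⊆ (j (toV δ.ord.toZFSet)).1 := by
    intro x hx
    obtain ⟨ξ, hξ, hx⟩ := mem_supImage.1 hx
    refine hδ.mem_trans hx ((mem_map_iff j).2 ?_)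
    exact Ordinal.toZFSet_mem_toZFSet_iff.2 hξ
  rcases ((isOrdinal_supImage j).subset_iff_eq_or_mem hδ).1 hsub with h | h
  · rw [h]; exact (j _).2
  · exact mem_of_mem _ h

/-- The supremum of the image of `δ`, as a point of the target. -/
noncomputable def supPoint (j : V.{u} ↪ₑ[setLang] M) (δ : Cardinal.{u}) : M :=
  ⟨supImage j δ, supImage_mem_carrier j δ⟩

lemma map_mem_supImage_comp (j : V.{u} ↪ₑ[setLang] M) (i : M ↪ₑ[setLang] N) {x : M}
    (hx : x.1 ∈ supImage j δ) : (i x).1 ∈ supImage (i.comp j) δ := by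
  obtain ⟨ξ, hξ, h⟩ := mem_supImage.1 hx
  exact mem_supImage.2 ⟨ξ, hξ, (mem_map_iff i).2 h⟩

lemma map_mem_supImage (hδ : δ.IsRegular) (j : V.{u} ↪ₑ[setLang] M) {ξ : Ordinal.{u}}
    (hξ : ξ < δ.ord) : (j (toV ξ.toZFSet)).1 ∈ supImage j δ := by
  refine mem_supImage.2 ⟨Order.succ ξ, (Cardinal.isSuccLimit_ord hδ.aleph0_le).succ_lt hξ,
    (mem_map_iff j).2 ?_⟩
  exact Ordinal.toZFSet_mem_toZFSet_iff.2 (Order.lt_succ ξ)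

/-- An internal embedding is continuous at ordinals that are not tail uniform: a discontinuity
yields a derived tail ultrafilter. -/
lemma map_supPoint (hδ : δ.IsRegular) (j : V.{u} ↪ₑ[setLang] M) {i : M ↪ₑ[setLang] N}
    (hi : IsInternalUltrapower i) (hT : ¬ IsTailUniformIn M (supImage j δ)) :
    i (supPoint j δ) = supPoint (i.comp j) δ := by
  have hiord := isOrdinal_map i (x := supPoint j δ) (isOrdinal_supImage j)
  have hsub : supImage (i.comp j) δ ⊆ (i (supPoint j δ)).1 := by
    intro x hx
    obtain ⟨ξ, hξ, hx⟩ := mem_supImage.1 hx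
    exact hiord.mem_trans hx ((mem_map_iff i).2 (map_mem_supImage hδ j hξ))
  rcases ((isOrdinal_supImage _).subset_iff_eq_or_mem hiord).1 hsub with h | h
  · exact Subtype.ext h.symm
  refine absurd ?_ hT
  obtain ⟨D, hD⟩ := hi.exists_isDerived j (supPoint j δ) (supPoint (i.comp j) δ)
  refine ⟨D.1, hD.isUltrafilterIn j h, hD.isCountablyCompleteIn j h, fun β hβ => ?_⟩
  let β' : M := ⟨β, mem_of_mem (supPoint j δ) hβ⟩
  obtain ⟨Z, hZ⟩ := exists_sdiff j (supPoint j δ) β'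
  refine (show Z.1 = supImage j δ \ β from hZ) ▸ (hD Z).2 ⟨fun t ht => ?_, ?_⟩
  · exact (ZFSet.mem_sdiff.1 (hZ ▸ ht)).1
  · rw [map_sdiff i hZ, ZFSet.mem_sdiff]
    exact ⟨h, ZFSet.mem_asymm (map_mem_supImage_comp j i (x := β') hβ)⟩

end SupImage

/-! ### Comparisons give the universal property -/

/-- An embedding whose range contains the range of another one factors it. -/
lemma exists_factor {M M' N : TransClass.{u}} (i₀ : M' ↪ₑ[setLang] N) (i₁ : M ↪ₑ[setLang] N)
    (x₀ : M) (h : ∀ y, ∃ z, i₀ z = i₁ y) : ∃ k : M ↪ₑ[setLang] M', ∀ y, i₀ (k y) = i₁ y := by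
  choose k hk using h
  refine ⟨elementaryOfFO k x₀ fun P hP v => ?_, hk⟩
  rw [← hP.map_iff i₀, ← hP.map_iff i₁]
  simp only [hk]

lemma IsKetonen.hull_eq {M : TransClass.{u}} {δ : Cardinal.{u}} {j : V.{u} ↪ₑ[setLang] M}
    (hj : IsKetonen δ j) : hull M (Set.range j ∪ {supPoint j δ}) = Set.univ := by
  rw [← hj.1]
  congr 2
  ext x
  exact Subtype.ext_iff

theorem KU_of_hasComparison {δ : Cardinal.{u}} (hδ : δ.IsRegular)
    (h : ∀ (M₀ M₁ : TransClass.{u}) (j₀ : V.{u} ↪ₑ[setLang] M₀) (j₁ : V.{u} ↪ₑ[setLang] M₁),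
        IsUltrapower j₀ → IsKetonen δ j₁ → HasComparison j₀ j₁) : KU δ := by
  intro M M' j j' hj hj'
  obtain ⟨N, i₀, i₁, hi₀, hi₁, hcomm⟩ := h M' M j' j hj'.1 hj
  have hpt : i₁ (supPoint j δ) = i₀ (supPoint j' δ) := by
    rw [map_supPoint hδ j hi₁ hj.2, map_supPoint hδ j' hi₀ hj'.2]
    have : i₁.comp j = i₀.comp j' := Language.ElementaryEmbedding.ext fun x => (hcomm x).symm
    rw [this]
  have hgen := (hull_eq_univ_iff (.refl setLang V) j).1 hj.hull_eq
  obtain ⟨k, hk⟩ := exists_factor i₀ i₁ (j (toV ∅)) fun y => by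
    obtain ⟨f, rfl⟩ := hgen y
    exact ⟨M'.app (j' f) (supPoint j' δ), by rw [map_app, map_app, hcomm, hpt]⟩
  have hkj : ∀ x, j' x = k (j x) := fun x => i₀.injective (by rw [hcomm, hk])
  refine ⟨k, ?_, hkj⟩
  obtain ⟨x, hx⟩ := hj'.1
  have hgen' := (hull_eq_univ_iff (.refl setLang V) j').1 hx
  obtain ⟨a, ha⟩ := exists_mem_map j' x
  rw [hkj] at ha
  obtain ⟨D, hD⟩ := hi₁.exists_isDerived j (j a) (i₀ x)
  refine isInternalUltrapower_of_isDerived j k (fun y => ?_) ha (D := D) fun X => ?_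
  · obtain ⟨f, rfl⟩ := hgen' y
    exact ⟨j f, by rw [hkj]⟩
  · rw [hD X, ← hk X, mem_map_iff]

/-! ### Internal ultrapowers -/

section Ultrapower

open Filter

variable {M : TransClass.{u}} {A U : M}

/-- The filter on the points of `M` that is generated by the members of the set `U`. -/
noncomputable def modelFilter (U : M) : Filter M := (setFilter U.1).comap Subtype.val

lemma IsUltrafilterIn.eventually_modelFilter (hU : IsUltrafilterIn M A.1 U.1) {p : M → Prop} :
    (∀ᶠ x in modelFilter U, p x) ↔ ∃ B : M, B.1 ∈ U.1 ∧ ∀ x : M, x.1 ∈ B.1 → p x := by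
  rw [modelFilter, Filter.eventually_comap, hU.eventually_iff, exists_mem_iff U]
  refine exists_congr fun B => and_congr_right fun _ => ?_
  exact ⟨fun h x hx => h x.1 hx x rfl, fun h t ht x hx => h x (hx ▸ ht)⟩

lemma IsUltrafilterIn.eventually_modelFilter_mem (hU : IsUltrafilterIn M A.1 U.1) :
    ∀ᶠ x in modelFilter U, x.1 ∈ A.1 :=
  hU.eventually_modelFilter.2 ⟨A, hU.whole_mem, fun _ h => h⟩

lemma IsUltrafilterIn.neBot_modelFilter (hU : IsUltrafilterIn M A.1 U.1) :
    (modelFilter U).NeBot := by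
  refine ⟨fun hb => ?_⟩
  obtain ⟨B, hB, hB'⟩ := hU.eventually_modelFilter.1 (Filter.eventually_false_iff_eq_bot.2 hb)
  refine hU.empty_notMem ?_
  rw [(ZFSet.eq_empty B.1).2 fun y hy => hB' ⟨y, mem_of_mem B hy⟩ hy] at hB
  exact hB

variable {P : ∀ M : TransClass.{u}, (ℕ → M) → Prop}

lemma IsUltrafilterIn.not_eventually_modelFilter (j : V.{u} ↪ₑ[setLang] M)
    (hU : IsUltrafilterIn M A.1 U.1) (hP : FO P) (v : ℕ → M) :
    (¬ ∀ᶠ x in modelFilter U, P M (scons x v)) ↔ ∀ᶠ x in modelFilter U, ¬ P M (scons x v) := by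
  have := hU.neBot_modelFilter
  refine ⟨fun h => ?_, fun h h' => (h.and h').exists.elim fun x hx => hx.1 hx.2⟩
  obtain ⟨B, hB⟩ := exists_sep j hP v A
  obtain ⟨C, hC⟩ := exists_sdiff j A B
  rcases hU.ultra B.1 B.2 fun t ht => ((hB ⟨t, mem_of_mem B ht⟩).1 ht).1 with hBU | hCU
  · exact absurd (hU.eventually_modelFilter.2 ⟨B, hBU, fun x hx => ((hB x).1 hx).2⟩) h
  · rw [← hC] at hCU
    refine hU.eventually_modelFilter.2 ⟨C, hCU, fun x hx hPx => ?_⟩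
    rw [hC, ZFSet.mem_sdiff] at hx
    exact hx.2 ((hB x).2 ⟨hx.1, hPx⟩)

lemma IsUltrafilterIn.exists_choice (j : V.{u} ↪ₑ[setLang] M)
    (hU : IsUltrafilterIn M A.1 U.1) (hP : FO P) (v : ℕ → M)
    (h : ∀ᶠ x in modelFilter U, ∃ y, P M (scons y (scons x v))) :
    ∃ f : M, ∀ᶠ x in modelFilter U, P M (scons (M.app f x) (scons x v)) := by
  obtain ⟨f, hf⟩ := KetonenUniv.exists_choice j hP v A
  refine ⟨f, ?_⟩
  filter_upwards [h, hU.eventually_modelFilter_mem] with x hx hxA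
  exact hf x hxA hx

lemma FO.app_env (hP : FO P) : FO fun M v => P M (fun n => M.app (v (n + 1)) (v 0)) :=
  hP.subst (fun M v n => M.app (v (n + 1)) (v 0)) fun i => .eq_app 0 (i + 1 + 1) 1

/-- The membership relation of the ultrapower of `M` by `U`. -/
def UltMem (U h f : M) : Prop := ∀ᶠ x in modelFilter U, (M.app h x).1 ∈ (M.app f x).1

lemma wellFounded_ultMem (j : V.{u} ↪ₑ[setLang] M) (hU : IsUltrafilterIn M A.1 U.1)
    (hc : IsCountablyCompleteIn M A.1 U.1) : WellFounded (UltMem U) := by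
  rw [wellFounded_iff_isEmpty_descending_chain]
  refine ⟨fun ⟨s, hs⟩ => ?_⟩
  choose a ha using fun n => exists_mem_map j (s n)
  let S : M := j (toV (ZFSet.iUnion fun n => (a n).1))
  have hsS : ∀ n, (s n).1 ∈ S.1 := fun n =>
    (subset_map_iff j (x := a n)).2 (ZFSet.subset_iUnion (fun n => (a n).1) n) (ha n)
  obtain ⟨g, hg⟩ := exists_collapse j hU hc S
  refine (wellFounded_iff_isEmpty_descending_chain.1 ZFSet.mem_wf).false
    ⟨fun n => app g.1 (s n).1, fun n => ?_⟩
  exact (hg (s n) (hsS n) (M.app g (s (n + 1)))).2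
    ⟨s (n + 1), hsS _, rfl, hU.eventually_modelFilter.1 (hs n)⟩

/-- The ultrapower of `M` by `U`, whose membership relation is well-founded, is isomorphic to a
transitive class: `π f` is the collapse of the class of `f`. -/
lemma exists_collapse_ultMem (j : V.{u} ↪ₑ[setLang] M) (hU : IsUltrafilterIn M A.1 U.1)
    (hc : IsCountablyCompleteIn M A.1 U.1) :
    ∃ (N : TransClass.{u}) (π : M → N), Function.Surjective π ∧
      (∀ f g, (π f).1 ∈ (π g).1 ↔ UltMem U f g) ∧
      ∀ f g, π f = π g ↔ ∀ᶠ x in modelFilter U, M.app f x = M.app g x := by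
  have hwf := wellFounded_ultMem j hU hc
  have hne := hU.neBot_modelFilter
  -- a set of representatives for the members of a given point of the ultrapower
  have hrep : ∀ f : M, ∃ S : M, ∀ h, UltMem U h f → ∃ h' : M, h'.1 ∈ S.1 ∧
      ∀ᶠ x in modelFilter U, M.app h' x = M.app h x := by
    intro f
    obtain ⟨a, ha⟩ := exists_mem_map j f
    obtain ⟨S, haS, -, hS⟩ := exists_closed_functions j (j a) A
    refine ⟨S, fun h hh => ?_⟩
    obtain ⟨h', hh', heq⟩ := hS f (haS ha) h
    refine ⟨h', hh', ?_⟩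
    filter_upwards [hh, hU.eventually_modelFilter_mem] with x hx hxA
    exact heq x hxA hx
  choose B hB using hrep
  have hsmall : ∀ f : M, Small.{u} {h : M // h.1 ∈ (B f).1 ∧ UltMem U h f} := fun f =>
    small_of_injective (β := ((B f).1 : ZFSet.{u})) (f := fun h => ⟨h.1.1, h.2.1⟩)
      fun x y hxy => Subtype.ext (Subtype.ext (Subtype.mk.inj hxy))
  let F : M → ZFSet.{u} := hwf.fix fun f ih =>
    ZFSet.range fun h : {h : M // h.1 ∈ (B f).1 ∧ UltMem U h f} => ih h.1 h.2.2
  have hF : ∀ f, F f = ZFSet.range fun h : {h : M // h.1 ∈ (B f).1 ∧ UltMem U h f} => F h.1 :=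
    fun f => hwf.fix_eq _ f
  have hF' : ∀ f y, y ∈ F f ↔ ∃ h : M, h.1 ∈ (B f).1 ∧ UltMem U h f ∧ F h = y := by
    intro f y
    rw [hF f, ZFSet.mem_range]
    exact ⟨fun ⟨h, hy⟩ => ⟨h.1, h.2.1, h.2.2, hy⟩, fun ⟨h, h1, h2, hy⟩ => ⟨⟨h, h1, h2⟩, hy⟩⟩
  have hmem_congr : ∀ {f f' g g' : M}, (∀ᶠ x in modelFilter U, M.app f x = M.app f' x) →
      (∀ᶠ x in modelFilter U, M.app g x = M.app g' x) → UltMem U f g → UltMem U f' g' := by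
    intro f f' g g' hf hg h
    unfold UltMem
    filter_upwards [hf, hg, h] with x h1 h2 h3
    rwa [← h1, ← h2]
  have hcongr : ∀ f g, (∀ᶠ x in modelFilter U, M.app f x = M.app g x) → F f = F g := by
    intro f
    induction f using hwf.induction with
    | h f ih =>
      intro g hfg
      have hgf : ∀ᶠ x in modelFilter U, M.app g x = M.app f x := hfg.mono fun x hx => hx.symm
      refine ZFSet.ext fun y => ⟨fun hy => ?_, fun hy => ?_⟩
      · obtain ⟨h, _, hh, rfl⟩ := (hF' f y).1 hy
        have hhg := hmem_congr (.of_forall fun _ => rfl) hfg hh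
        obtain ⟨h', hh', heq⟩ := hB g h hhg
        have heq' : ∀ᶠ x in modelFilter U, M.app h x = M.app h' x := heq.mono fun x hx => hx.symm
        exact (hF' g _).2 ⟨h', hh', hmem_congr heq' (.of_forall fun _ => rfl) hhg,
          (ih h hh h' heq').symm⟩
      · obtain ⟨h, _, hh, rfl⟩ := (hF' g y).1 hy
        have hhf := hmem_congr (.of_forall fun _ => rfl) hgf hh
        obtain ⟨h', hh', heq⟩ := hB f h hhf
        have heq' : ∀ᶠ x in modelFilter U, M.app h x = M.app h' x := heq.mono fun x hx => hx.symm
        have hh'f := hmem_congr heq' (.of_forall fun _ => rfl) hhf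
        exact (hF' f _).2 ⟨h', hh', hh'f, ih h' hh'f h heq⟩
  have hmem : ∀ f y, y ∈ F f ↔ ∃ h : M, UltMem U h f ∧ F h = y := by
    refine fun f y => ⟨fun h => ?_, ?_⟩
    · obtain ⟨h, _, hh⟩ := (hF' f y).1 h
      exact ⟨h, hh⟩
    · rintro ⟨h, hh, rfl⟩
      obtain ⟨h', hh', heq⟩ := hB f h hh
      exact (hF' f _).2 ⟨h', hh', hmem_congr (heq.mono fun x hx => hx.symm)
        (.of_forall fun _ => rfl) hh, hcongr _ _ heq⟩
  -- extensionality of the ultrapower: functions that differ almost everywhere differ almost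
  -- everywhere by a point chosen in `M`
  have hdiff : ∀ f g : M, (∀ h, UltMem U h f ↔ UltMem U h g) →
      ∀ᶠ x in modelFilter U, M.app f x = M.app g x := by
    intro f g hfg
    by_contra hcon
    have hFO : FO.{u} fun M v => M.app (v 1) (v 0) = M.app (v 2) (v 0) :=
      .comp_app (R := fun M v y => y = M.app (v 2) (v 0)) (.eq_app _ _ _) 1 0
    have hne' := (hU.not_eventually_modelFilter j hFO (scons f fun _ => g)).1 hcon
    have hFO' : FO.{u} fun M v => ¬ ((v 0).1 ∈ (M.app (v 2) (v 1)).1 ↔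
        (v 0).1 ∈ (M.app (v 3) (v 1)).1) :=
      .not (.comp_app (R := fun M v y => (v 0).1 ∈ y.1 ↔ (v 0).1 ∈ (M.app (v 3) (v 1)).1)
        (.comp_app (R := fun M v y => (v 1).1 ∈ (v 0).1 ↔ (v 1).1 ∈ y.1)
          (.iff (.mem _ _) (.mem _ _)) 4 2) 2 1)
    obtain ⟨p, hp⟩ := hU.exists_choice j hFO' (scons f fun _ => g) <| hne'.mono fun x hx => by
      by_contra! h
      exact hx (TransClass.ext_iff.2 fun t => h t)
    by_cases hpf : UltMem U p f
    · have hpg := (hfg p).1 hpf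
      obtain ⟨x, ⟨h1, h2⟩, h3⟩ := ((hpf.and hpg).and hp).exists
      exact h3 (iff_of_true h1 h2)
    · have hpg : ¬ UltMem U p g := fun h => hpf ((hfg p).2 h)
      have hFO'' : FO.{u} fun M v => (M.app (v 1) (v 0)).1 ∈ (M.app (v 2) (v 0)).1 :=
        .app_mem_app 1 0 2 0
      have h1 := (hU.not_eventually_modelFilter j hFO'' (scons p fun _ => f)).1 hpf
      have h2 := (hU.not_eventually_modelFilter j hFO'' (scons p fun _ => g)).1 hpg
      obtain ⟨x, ⟨h1, h2⟩, h3⟩ := ((h1.and h2).and hp).exists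
      exact h3 (iff_of_false h1 h2)
  have hinj : ∀ f g, F f = F g → ∀ᶠ x in modelFilter U, M.app f x = M.app g x := by
    intro f
    induction f using hwf.induction with
    | h f ih =>
      refine fun g hfg => hdiff f g fun h => ⟨fun hh => ?_, fun hh => ?_⟩
      · obtain ⟨q, hq, hqh⟩ := (hmem g _).1 (hfg ▸ (hmem f _).2 ⟨h, hh, rfl⟩)
        exact hmem_congr ((ih h hh q hqh.symm).mono fun x hx => hx.symm)
          (.of_forall fun _ => rfl) hq
      · obtain ⟨q, hq, hqh⟩ := (hmem f _).1 (hfg ▸ (hmem g _).2 ⟨h, hh, rfl⟩)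
        exact hmem_congr (ih q hq h hqh) (.of_forall fun _ => rfl) hq
  let N : TransClass.{u} := ⟨Set.range F, by
    rintro _ ⟨f, rfl⟩ y hy
    obtain ⟨h, _, rfl⟩ := (hmem f y).1 hy
    exact ⟨h, rfl⟩⟩
  refine ⟨N, fun f => ⟨F f, f, rfl⟩, ?_, fun f g => ?_, fun f g => ?_⟩
  · rintro ⟨_, f, rfl⟩
    exact ⟨f, rfl⟩
  · change F f ∈ F g ↔ _
    rw [hmem]
    refine ⟨fun ⟨h, hh, hhf⟩ => ?_, fun h => ⟨f, h, rfl⟩⟩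
    exact hmem_congr (hinj h f hhf) (.of_forall fun _ => rfl) hh
  · rw [Subtype.ext_iff]
    exact ⟨hinj f g, hcongr f g⟩

/-- Łoś's theorem for the ultrapower of `M` by `U`. -/
lemma ultrapower_realize_iff (j : V.{u} ↪ₑ[setLang] M) (hU : IsUltrafilterIn M A.1 U.1)
    {N : TransClass.{u}} {π : M → N} (hπ : Function.Surjective π)
    (hmem : ∀ f g, (π f).1 ∈ (π g).1 ↔ UltMem U f g)
    (heq : ∀ f g, π f = π g ↔ ∀ᶠ x in modelFilter U, M.app f x = M.app g x)
    (hP : FO P) (v : ℕ → M) :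
    P N (fun n => π (v n)) ↔ ∀ᶠ x in modelFilter U, P M (fun n => M.app (v n) x) := by
  have hne := hU.neBot_modelFilter
  induction hP generalizing v with
  | mem i j => exact hmem _ _
  | eq i j => exact heq _ _
  | bot => exact ⟨fun h => h.elim, fun h => h.exists.elim fun _ h => h⟩
  | @imp P Q hP _ h₁ h₂ =>
    refine (imp_congr (h₁ v) (h₂ v)).trans ?_
    refine ⟨fun h => ?_, fun h h' => h.mp (h'.mono fun _ h1 h2 => h2 h1)⟩
    by_cases hP' : ∀ᶠ x in modelFilter U, P M (fun n => M.app (v n) x)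
    · exact (h hP').mono fun _ h _ => h
    · exact ((hU.not_eventually_modelFilter j hP.app_env v).1 hP').mono fun _ h h' => absurd h' h
  | @allCons P hP ih =>
    have hiff : (∀ y : N, P N (scons y fun n => π (v n))) ↔
        ∀ f : M, ∀ᶠ x in modelFilter U, P M (scons (M.app f x) fun n => M.app (v n) x) := by
      rw [hπ.forall]
      refine forall_congr' fun f => ?_
      rw [← scons_comp]
      refine (ih _).trans (iff_of_eq (congrArg (fun p : M → Prop => ∀ᶠ x in modelFilter U, p x) ?_))
      funext x
      rw [scons_comp (fun t => M.app t x)]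
    refine hiff.trans ⟨fun h => ?_, fun h f => h.mono fun x hx => hx _⟩
    have hFO : FO fun M v => ∀ y : M, P M (scons y fun n => M.app (v (n + 1)) (v 0)) :=
      (FO.allCons hP).app_env
    have hFO' : FO fun M v => ¬ P M (scons (v 0) fun n => M.app (v (n + 2)) (v 1)) :=
      .not <| hP.subst (fun M v => scons (v 0) fun n => M.app (v (n + 2)) (v 1)) fun i => by
        cases i with
        | zero => exact .eq 0 1
        | succ i => exact .eq_app 0 (i + 2 + 1) 2
    by_contra hcon
    have hcon' := (hU.not_eventually_modelFilter j hFO v).1 hcon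
    obtain ⟨f, hf⟩ := hU.exists_choice j hFO' v <| hcon'.mono fun x hx => not_forall.1 hx
    obtain ⟨x, h1, h2⟩ := ((h f).and hf).exists
    exact h2 h1

/-- A countably complete ultrafilter of `M` is derived from an ultrapower embedding of `M`. -/
theorem exists_ultrapower (j : V.{u} ↪ₑ[setLang] M) (hU : IsUltrafilterIn M A.1 U.1)
    (hc : IsCountablyCompleteIn M A.1 U.1) :
    ∃ (N : TransClass.{u}) (k : M ↪ₑ[setLang] N) (x : N),
      (∀ y, ∃ f : M, y = N.app (k f) x) ∧ x.1 ∈ (k A).1 ∧ IsDerived k A x U := by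
  obtain ⟨N, π, hπ, hmem, heq⟩ := exists_collapse_ultMem j hU hc
  have hne := hU.neBot_modelFilter
  have hconst : ∀ y : M, ∃ c : M, ∀ᶠ x in modelFilter U, M.app c x = y := by
    intro y
    obtain ⟨c, hc⟩ := hU.exists_choice j (.eq 0 2) (fun _ => y) (.of_forall fun x => ⟨y, rfl⟩)
    exact ⟨c, hc⟩
  choose c hcy using hconst
  obtain ⟨ι, hι⟩ := hU.exists_choice j (.eq 0 1) (fun _ => A) (.of_forall fun x => ⟨x, rfl⟩)
  replace hι : ∀ᶠ x in modelFilter U, M.app ι x = x := hι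
  let k : M ↪ₑ[setLang] N := elementaryOfFO (fun y => π (c y)) A fun P hP v => by
    rw [ultrapower_realize_iff j hU hπ hmem heq hP]
    obtain ⟨n, hn⟩ := hP.exists_support
    have : ∀ᶠ x in modelFilter U, ∀ i < n, M.app (c (v i)) x = v i :=
      (Set.finite_Iio n).eventually_all.2 fun i _ => hcy (v i)
    have h : ∀ᶠ x in modelFilter U, (P M (fun i => M.app (c (v i)) x) ↔ P M v) :=
      this.mono fun x hx => hn M _ _ hx
    rw [Filter.eventually_congr h, Filter.eventually_const]
  have hx : ∀ X : M, (π ι).1 ∈ (k X).1 ↔ ∀ᶠ x in modelFilter U, x.1 ∈ X.1 := by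
    intro X
    refine (hmem ι (c X)).trans (Filter.eventually_congr ?_)
    filter_upwards [hι, hcy X] with x h1 h2
    rw [h1, h2]
  refine ⟨N, k, π ι, fun y => ?_, (hx A).2 hU.eventually_modelFilter_mem, fun X => ?_⟩
  · obtain ⟨f, rfl⟩ := hπ y
    refine ⟨f, (ultrapower_realize_iff j hU hπ hmem heq (FO.eq_app 0 1 2)
      (scons f (scons (c f) fun _ => ι))).2 ?_⟩
    filter_upwards [hι, hcy f] with x h1 h2
    change M.app f x = M.app (M.app (c f) x) (M.app ι x)
    rw [h1, h2]
  · rw [hx]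
    constructor
    · exact fun hX => ⟨hU.subset _ hX, hU.eventually_modelFilter.2 ⟨X, hX, fun _ h => h⟩⟩
    · rintro ⟨hXA, hX⟩
      obtain ⟨B, hB, hBX⟩ := hU.eventually_modelFilter.1 hX
      exact hU.upward B.1 hB X.1 X.2 (fun t ht => hBX ⟨t, mem_of_mem B ht⟩ ht) hXA

end Ultrapower

/-! ### The universal property gives comparisons -/

lemma isInternalUltrapower_refl {M : TransClass.{u}} (j : V.{u} ↪ₑ[setLang] M) :
    IsInternalUltrapower (Language.ElementaryEmbedding.refl setLang M) := by
  let x : M := j (toV ∅)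
  refine ⟨⟨x, Set.eq_univ_of_forall fun y => ?_⟩, fun a => ?_⟩
  · exact mem_hull_of_FO (FO.eq 0 1) (fun _ => ⟨y, .inl ⟨y, rfl⟩⟩) fun z => Iff.rfl
  · have h : FO.{u} fun M v => ∀ a : M, ∃ r : M, ∀ p : M, p.1 ∈ r.1 ↔
        ∃ y : M, y.1 ∈ a.1 ∧ p.1 = ZFSet.pair y.1 y.1 :=
      .all (.ex (.all (.iff (.mem _ _) (.ex (.and (.mem _ _) (.eq_pair _ _ _))))))
    obtain ⟨r, hr⟩ := h.transfer j (fun v a => by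
      refine ⟨toV (graph a.1 id), fun p => ?_⟩
      rw [toV_val, graph, ZFSet.mem_range]
      exact ⟨fun ⟨y, hp⟩ => ⟨toV y.1, y.2, hp.symm⟩, fun ⟨y, hy, hp⟩ => ⟨⟨y.1, hy⟩, hp.symm⟩⟩)
      (fun _ => a) a
    refine ⟨r, fun p => ⟨fun hp => (hr ⟨p, mem_of_mem r hp⟩).1 hp, ?_⟩⟩
    rintro ⟨y, hy, rfl⟩
    exact (hr ⟨_, pair_mem_carrier j y y⟩).2 ⟨y, hy, rfl⟩

/-- Every embedding of the universe extends by an internal ultrapower embedding of its target to an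
embedding that sends `δ` to a supremum that is not tail uniform: if `sup j[δ]` is tail uniform,
the ultrapower by a minimal tail ultrafilter does this, since a tail ultrafilter on the new
supremum would be represented by functions that reduce the minimal one. -/
theorem exists_internal_not_tailUniform {M : TransClass.{u}} {δ : Cardinal.{u}}
    (hδ : δ.IsRegular) (j : V.{u} ↪ₑ[setLang] M) :
    ∃ (N : TransClass.{u}) (k : M ↪ₑ[setLang] N), IsInternalUltrapower k ∧
      ¬ IsTailUniformIn N (supImage (k.comp j) δ) := by
  by_cases hT : IsTailUniformIn M (supImage j δ)
  swap
  · exact ⟨M, .refl setLang M, isInternalUltrapower_refl j, hT⟩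
  let o : M := ⟨_, omega0_mem_carrier j⟩
  have hord := isOrdinal_supImage (δ := δ) j
  obtain ⟨U, ⟨hU, hc, htail⟩, hmin⟩ := exists_not_isReducedBy j (A := supPoint j δ) (o := o) rfl
    hord.isTransitive hT
  obtain ⟨N, k, x, hgen, hx, hD⟩ := exists_ultrapower j hU hc
  refine ⟨N, k, isInternalUltrapower_of_isDerived j k hgen hx hD, fun hTN => hmin ?_⟩
  obtain ⟨W, hW, hWc, hWt⟩ := hTN
  obtain ⟨g, hg⟩ := hgen (supPoint (k.comp j) δ)
  obtain ⟨w, hw⟩ := hgen ⟨W, hW.mem_model⟩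
  have hgs : (N.app (k g) x).1 = supImage (k.comp j) δ := (congrArg Subtype.val hg).symm
  have hwW : (N.app (k w) x).1 = W := (congrArg Subtype.val hw).symm
  have hxord : x.1.IsOrdinal := (isOrdinal_map k (x := supPoint j δ) hord).mem hx
  refine ⟨g, w, ?_, fun β hβ => ?_⟩
  · refine (hD.realize_iff j hx (FO.reducedBy_fst 0 3 1 2) (scons g (scons w fun _ => o))).1 ?_
    change (N.app (k g) x).1 ⊆ x.1 ∧ IsUltrafilterIn N (N.app (k g) x).1 (N.app (k w) x).1 ∧
      IsCompleteIn N (k o).1 (N.app (k g) x).1 (N.app (k w) x).1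
    rw [hgs, hwW, map_omega0 k (o := o) rfl]
    refine ⟨fun t ht => ?_, hW, hWc⟩
    obtain ⟨ξ, hξ, ht⟩ := mem_supImage.1 ht
    -- `x` lies above `k (j ξ)` as `U` contains the tail above `j ξ`
    obtain ⟨Z, hZ⟩ := exists_sdiff j (supPoint j δ) (j (toV ξ.toZFSet))
    have hZU := htail _ (map_mem_supImage hδ j hξ)
    rw [← hZ] at hZU
    have hxZ := ((hD Z).1 hZU).2
    rw [map_sdiff k hZ, ZFSet.mem_sdiff] at hxZ
    have hjξ : (j (toV ξ.toZFSet)).1.IsOrdinal :=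
      isOrdinal_map j (x := toV ξ.toZFSet) (ZFSet.isOrdinal_toZFSet ξ)
    exact (hxord.notMem_iff_subset (isOrdinal_map k hjξ)).1 hxZ.2 ht
  · refine (hD.realize_iff j hx (FO.reducedBy_snd 0 3 1 2) (scons g (scons w fun _ => β))).1 ?_
    change (N.app (k g) x).1 \ (k β).1 ∈ (N.app (k w) x).1
    rw [hgs, hwW]
    exact hWt _ (map_mem_supImage_comp j k hβ)

theorem hasComparison_of_KU {δ : Cardinal.{u}} (hδ : δ.IsRegular) (h : KU δ)
    {M₀ M₁ : TransClass.{u}} {j₀ : V.{u} ↪ₑ[setLang] M₀} {j₁ : V.{u} ↪ₑ[setLang] M₁}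
    (hj₀ : IsUltrapower j₀) (hj₁ : IsKetonen δ j₁) : HasComparison j₀ j₁ := by
  obtain ⟨N, k, hk, hT⟩ := exists_internal_not_tailUniform hδ j₀
  obtain ⟨i, hi, hcomm⟩ := h M₁ N j₁ (k.comp j₀) hj₁ ⟨hj₀.comp hk.1, hT⟩
  exact ⟨N, k, i, hk, hi, hcomm⟩

end KetonenUniv

open KetonenUniv
theorem mainTheorem12 (δ : Cardinal.{u}) (hδ : δ.IsRegular) :
    KU δ ↔
      ∀ (M₀ M₁ : TransClass.{u}) (j₀ : V.{u} ↪ₑ[setLang] M₀) (j₁ : V.{u} ↪ₑ[setLang] M₁),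
        IsUltrapower j₀ → IsKetonen δ j₁ → HasComparison j₀ j₁ :=
  ⟨fun h _ _ _ _ => hasComparison_of_KU hδ h, KU_of_hasComparison hδ⟩
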